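/- Let $q\ge 5$ be a power of a prime with $q\equiv 0\pmod 3$. In $\mathrm{PG}(3,q)$ with homogeneous coordinates $(x_0,x_1,x_2,x_3)$ let $\mathcal C=\{P(t)\mid t\in\mathbb F_q\cup\{\infty\}\}$ be the twisted cubic, where $P(t)=(t^3,t^2,t,1)$ for $t\in\mathbb F_q$ and $P(\infty)=(1,0,0,0)$, and let $G_q$ be the group of projectivities of $\mathrm{PG}(3,q)$ fixing $\mathcal C$ as a set. The osculating plane at $P(t)$, $t\in\mathbb F_q$, is $x_0-3tx_1+3t^2x_2-t^3x_3=0$, and the one at $P(\infty)$ is $x_3=0$. The tangent at $P(t)$, $t\in\mathbb F_q$, is the line through $(t^3,t^2,t,1)$ and $(3t^2,2t,1,0)$, and the tangent at $P(\infty)$ is the line through $(1,0,0,0)$ and $(0,1,0,0)$. A real chord is a line through two distinct points of $\mathcal C$; an imaginary chord is a line of $\mathrm{PG}(3,q)$ that, over $\mathbb F_{q^2}$, passes through the conjugate points $(t^3,t^2,t,1)$ and $(t^{3q},t^{2q},t^q,1)$ for some $t\in\mathbb F_{q^2}\setminus\mathbb F_q$. A point is a - $\mathrm{TO}$-point if it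 is off $\mathcal C$ and lies on a tangent and on exactly one osculating plane; - $\mathrm{RC}$-point if it is off $\mathcal C$ and lies on a real chord; - $\mathrm{IC}$-point if it lies on an imaginary chord. A $2_{\mathcal C}$-plane is a plane containing exactly two points of $\mathcal C$. A $\mathrm{Un\Gamma}$-line is a line that meets $\mathcal C$ in exactly one point and lies in no osculating plane. Then the $\mathrm{Un\Gamma}$-lines form exactly two orbits under $G_q$, which can be labelled $\mathrm{Un\Gamma}_1$ and $\mathrm{Un\Gamma}_2$ so that every line of $\mathrm{Un\Gamma}_1$ lies in exactly one $2_{\mathcal C}$-plane and every line of $\mathrm{Un\Gamma}_2$ lies in exactly three. With this labelling: - every line of $\mathrm{Un\Gamma}_1$ contains exactly $0$ $\mathrm{TO}$-points, $\frac{q+1}{2}$ $\mathrm{IC}$-points and $\frac{q-1}{2}$ $\mathrm{RC}$-points; - every line of $\mathrm{Un\Gamma}_2$ contains exactly $2$ $\mathrm{TO}$-points, $\frac{q-1}{2}$ $\mathrm{IC}$-points and $\frac{q-3}{2}$ $\mathrm{RC}$-points; - through every $\mathrm{TO}$-point there pass exactly $0$ lines of $\mathrm{Un\Gamma}_1$ and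 $q$ lines of $\mathrm{Un\Gamma}_2$; - through every $\mathrm{IC}$-point there pass exactly $\frac{q+1}{2}$ lines of $\mathrm{Un\Gamma}_1$ and $\frac{q-1}{2}$ lines of $\mathrm{Un\Gamma}_2$; - through every $\mathrm{RC}$-point there pass exactly $\frac{q-1}{2}$ lines of $\mathrm{Un\Gamma}_1$ and $\frac{q-3}{2}$ lines of $\mathrm{Un\Gamma}_2$. -/

import Mathlib

open scoped Pointwise LinearAlgebra.Projectivization Matrix

namespace TwistedCubic

/-- The vector `(t³, t², t, 1)`, over any commutative ring. -/
def affineVec {R : Type*} [CommRing R] (t : R) : Fin 4 → R := ![t ^ 3, t ^ 2, t, 1]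

/-- A coordinate vector of the point `P(t)` of the twisted cubic, for `t ∈ F ∪ {∞}`. -/
def cubicVec {F : Type*} [Field F] : Option F → (Fin 4 → F)
  | none => ![1, 0, 0, 0]
  | some t => affineVec t

theorem cubicVec_ne_zero {F : Type*} [Field F] (t : Option F) : cubicVec t ≠ 0 := by
  cases t with
  | none => intro h; simpa [cubicVec] using congrFun h 0
  | some t => intro h; simpa [cubicVec, affineVec] using congrFun h 3

/-- The point `P(t)` of `PG(3, q)`; `none` stands for `t = ∞`. -/
def cubicPoint {F : Type*} [Field F] (t : Option F) : ℙ F (Fin 4 → F) :=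
  Projectivization.mk F (cubicVec t) (cubicVec_ne_zero t)

/-- The twisted cubic, as a set of points of `PG(3, q)`. -/
def cubic (F : Type*) [Field F] : Set (ℙ F (Fin 4 → F)) := Set.range cubicPoint

/-- The group of projectivities fixing the twisted cubic, given through the linear maps that induce
them. Scalar maps act trivially on points, lines and planes, so it has the same orbits as its image
in `PGL(4, q)`. -/
def cubicGroup (F : Type*) [Field F] : Subgroup ((Fin 4 → F) ≃ₗ[F] (Fin 4 → F)) :=
  MulAction.stabilizer ((Fin 4 → F) ≃ₗ[F] (Fin 4 → F)) (cubic F)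

/-- Lines of `PG(3, q)` are the two-dimensional subspaces of `F⁴`. -/
def IsLine {F : Type*} [Field F] (l : Submodule F (Fin 4 → F)) : Prop := Module.finrank F l = 2

/-- Planes of `PG(3, q)` are the three-dimensional subspaces of `F⁴`. -/
def IsPlane {F : Type*} [Field F] (π : Submodule F (Fin 4 → F)) : Prop := Module.finrank F π = 3

/-- The set of points of `PG(3, q)` incident with a line or a plane. -/
def pointsOn {F : Type*} [Field F] (l : Submodule F (Fin 4 → F)) : Set (ℙ F (Fin 4 → F)) :=
  {p | p.submodule ≤ l}

/-- The plane `c₀x₀ + c₁x₁ + c₂x₂ + c₃x₃ = 0`. -/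
def planeOf {F : Type*} [Field F] (c : Fin 4 → F) : Submodule F (Fin 4 → F) where
  carrier := {x | c ⬝ᵥ x = 0}
  add_mem' := fun {x y} hx hy => by
    simp only [Set.mem_ofPred_eq] at hx hy ⊢
    rw [dotProduct_add, hx, hy, add_zero]
  zero_mem' := by simp
  smul_mem' := fun a x hx => by
    simp only [Set.mem_ofPred_eq] at hx ⊢
    rw [dotProduct_smul, hx, smul_zero]

/-- The osculating plane at `P(t)`. -/
def oscPlane {F : Type*} [Field F] : Option F → Submodule F (Fin 4 → F)
  | none => planeOf ![0, 0, 0, 1]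
  | some t => planeOf ![1, -3 * t, 3 * t ^ 2, -t ^ 3]

/-- The set of osculating planes (the osculating developable). -/
def oscPlanes (F : Type*) [Field F] : Set (Submodule F (Fin 4 → F)) := Set.range oscPlane

/-- The tangent to the twisted cubic at `P(t)`: it is spanned by `(t³, t², t, 1)` and its derivative
`(3t², 2t, 1, 0)`, and at `∞` (in the parameter `s = 1/t`) by `(1, 0, 0, 0)` and `(0, 1, 0, 0)`. -/
def tangent {F : Type*} [Field F] : Option F → Submodule F (Fin 4 → F)
  | none => Submodule.span F {![1, 0, 0, 0], ![0, 1, 0, 0]}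
  | some t => Submodule.span F {![t ^ 3, t ^ 2, t, 1], ![3 * t ^ 2, 2 * t, 1, 0]}

/-- A real chord: a line through two distinct points of the twisted cubic. -/
def IsRealChord {F : Type*} [Field F] (l : Submodule F (Fin 4 → F)) : Prop :=
  IsLine l ∧ ∃ s t : Option F, s ≠ t ∧ cubicPoint s ∈ pointsOn l ∧ cubicPoint t ∈ pointsOn l

/-- An imaginary chord: a line of `PG(3, q)` whose extension to the algebraic closure is the line
through the points `P(t)` and `P(t ^ q)`, for some `t` in `GF(q²)` and not in `GF(q)`. -/
def IsImaginaryChord {F : Type*} [Field F] (l : Submodule F (Fin 4 → F)) : Prop :=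
  IsLine l ∧ ∃ t : AlgebraicClosure F,
    t ∉ Set.range (algebraMap F (AlgebraicClosure F)) ∧ t ^ (Nat.card F ^ 2) = t ∧
    Submodule.span (AlgebraicClosure F)
        ((fun (v : Fin 4 → F) (i : Fin 4) => algebraMap F (AlgebraicClosure F) (v i)) '' l) =
      Submodule.span (AlgebraicClosure F) {affineVec t, affineVec (t ^ Nat.card F)}

/-- `TO`-points: the points off the cubic that lie on a tangent and on exactly one osculating
plane. -/
def TOPoints (F : Type*) [Field F] : Set (ℙ F (Fin 4 → F)) :=
  {p | p ∉ cubic F ∧ (∃ t : Option F, p ∈ pointsOn (tangent t)) ∧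
    {π ∈ oscPlanes F | p ∈ pointsOn π}.ncard = 1}

/-- `RC`-points: the points off the cubic that lie on a real chord. -/
def RCPoints (F : Type*) [Field F] : Set (ℙ F (Fin 4 → F)) :=
  {p | p ∉ cubic F ∧ ∃ l, IsRealChord l ∧ p ∈ pointsOn l}

/-- `IC`-points: the points on an imaginary chord. -/
def ICPoints (F : Type*) [Field F] : Set (ℙ F (Fin 4 → F)) :=
  {p | ∃ l, IsImaginaryChord l ∧ p ∈ pointsOn l}

/-- `UnΓ`-lines: the lines that meet the cubic in exactly one point and do not lie in any osculating
plane. -/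
def UnGLines (F : Type*) [Field F] : Set (Submodule F (Fin 4 → F)) :=
  {l | IsLine l ∧ (cubic F ∩ pointsOn l).ncard = 1 ∧ ∀ π ∈ oscPlanes F, ¬ l ≤ π}

/-- `2_C`-planes: the planes containing exactly two points of the cubic. -/
def twoCPlanes (F : Type*) [Field F] : Set (Submodule F (Fin 4 → F)) :=
  {π | IsPlane π ∧ (cubic F ∩ pointsOn π).ncard = 2}

/-- `O` is an orbit of lines under the group of projectivities fixing the cubic. -/
def IsLineOrbit {F : Type*} [Field F] (O : Set (Submodule F (Fin 4 → F))) : Prop :=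
  ∃ l, IsLine l ∧
    O = {m | ∃ g ∈ cubicGroup F, m = Submodule.map (g : (Fin 4 → F) →ₗ[F] (Fin 4 → F)) l}

/-- The number of points of the set `M` on the line `l`. -/
noncomputable def numPointsOn {F : Type*} [Field F] (M : Set (ℙ F (Fin 4 → F)))
    (l : Submodule F (Fin 4 → F)) : ℕ := {p ∈ M | p ∈ pointsOn l}.ncard

/-- The number of lines of the set `O` through the point `p`. -/
noncomputable def numLinesThrough {F : Type*} [Field F] (O : Set (Submodule F (Fin 4 → F)))
    (p : ℙ F (Fin 4 → F)) : ℕ := {l ∈ O | p ∈ pointsOn l}.ncard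

/-- The two orbits `O₁`, `O₂` of `UnΓ`-lines, with their labelling: they are distinct orbits which
together make up all the `UnΓ`-lines, and a line of `O₁` lies in exactly one `2_C`-plane, while a
line of `O₂` lies in exactly three. -/
def AreUnGOrbits {F : Type*} [Field F] (O₁ O₂ : Set (Submodule F (Fin 4 → F))) : Prop :=
  IsLineOrbit O₁ ∧ IsLineOrbit O₂ ∧ O₁ ≠ O₂ ∧ O₁ ∪ O₂ = UnGLines F ∧
  (∀ l ∈ O₁, {π ∈ twoCPlanes F | l ≤ π}.ncard = 1) ∧
  (∀ l ∈ O₂, {π ∈ twoCPlanes F | l ≤ π}.ncard = 3)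

end TwistedCubic

/-!
Everything is controlled by the Hessian form of a point. For `v = (v₀, v₁, v₂, v₃)`, the minors of
the Hankel matrix with rows `v₀ v₁ v₂` and `v₁ v₂ v₃` are, up to sign, the coefficients of a binary quadratic
form `hess v` on `F ∪ {∞}`, with discriminant `disc v`. It vanishes exactly when `v` is on the cubic,
and since it annihilates `v` through the two Hankel relations, its zeros are the ends of the chord
through `v`. So `RC`-points are those whose discriminant is a nonzero square, `IC`-points those whose
discriminant is a nonsquare, and the points of tangents are those whose discriminant vanishes
(`mk_mem_RCPoints`, `mk_mem_ICPoints`, `mk_mem_TOPoints`).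

In characteristic `3` the osculating planes form a pencil, and a point off its axis lies on exactly
one of them because cubing is bijective. The line joining `v` to `P(s)` is a `UnΓ`-line precisely
when neither the linear form `osc v s` of the osculating plane nor `hess v s` vanishes
(`mem_UnGLines_iff`). Moving `v` along the line changes `hess v s` by squares only, so its quadratic
character `ε = ±1` is an invariant of the line and defines the two classes `UnGClass F ε`.

The classes are orbits. The maps induced by `t ↦ k t + c` and `t ↦ 1 / t` act transitively on each of
them (`exists_map_eq`). Conversely, any element of the group can be composed with such maps to fix
`P(∞)`; projecting from `P(∞)` gives three quadratic polynomials satisfying the equation of a conic at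
all elements of `F`, hence identically because the degree `4` is less than `q`, and this forces the
Hessian form at `∞` to be multiplied by a square (`conic_stabilizer`, `exists_factors_of_fix_infty`).

The counts are values of quadratic character sums. Through `v` there pass as many lines of class `ε`
as there are `s` with `osc v s ≠ 0` and `hess v s` of character `ε`; a form with nonzero discriminant
takes square and nonsquare values equally often (`two_mul_ncard_quadraticChar_formVal`), and at the
one `s` with `osc v s = 0` its value is a square (`two_mul_numLinesThrough`). On a line, the syzygy
`osc_sq_mul_disc` makes the discriminant a polynomial `(x + e)² - h³`, where `h` has character `ε`, so
that the points of each kind are counted by `∑ χ(u² - δ) = -1` (`numPointsOn_UnGClass`). A plane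
through `P(∞)` contains exactly one further point of the cubic when a polynomial of degree at most
`2` has exactly one zero, which happens for `2 + ε` planes through the line
(`ncard_twoCPlanes_UnGClass`).
-/

namespace TwistedCubic

/-! ### Character sums of quadratic polynomials -/

section CharacterSums

variable {F : Type*} [Field F]

/-- The value of the binary form `a X² + b X Y + c Y²` at a point of the projective line `F ∪ {∞}`,
with `∞ = (1 : 0)` and `t = (t : 1)`. -/
def formVal (a b c : F) : Option F → F
  | none => a
  | some t => a * t ^ 2 + b * t + c

theorem ncard_option [Finite F] (p : Option F → Prop) [DecidablePred p] :
    {s | p s}.ncard = {t | p (some t)}.ncard + if p none then 1 else 0 := by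
  have h : {s | p s} = some '' {t | p (some t)} ∪ (if p none then {none} else ∅) := by
    ext s
    cases s <;> split_ifs <;> simp_all
  rw [h, Set.ncard_union_eq, Set.ncard_image_of_injective _ (Option.some_injective F)]
  · split_ifs <;> simp
  · split_ifs <;> simp

theorem four_mul_formVal_some (a b c t : F) :
    4 * a * formVal a b c (some t) = (2 * a * t + b) ^ 2 - (b ^ 2 - 4 * a * c) := by
  simp only [formVal]
  ring

theorem affine_bijective {a : F} (b : F) (ha : a ≠ 0) : Function.Bijective fun t : F => a * t + b :=
  ⟨fun x y h => mul_left_cancel₀ ha (add_right_cancel h),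
    fun y => ⟨(y - b) / a, by field_simp; ring⟩⟩

theorem ncard_preimage_of_bijective {α β : Type*} {f : α → β} (hf : Function.Bijective f)
    (p : β → Prop) : {x | p (f x)}.ncard = {y | p y}.ncard := by
  rw [← Set.ncard_image_of_injective _ hf.1]
  congr 1
  ext y
  constructor
  · rintro ⟨x, hx, rfl⟩
    exact hx
  · intro hy
    obtain ⟨x, rfl⟩ := hf.2 y
    exact ⟨x, hy, rfl⟩

variable [Fintype F] [DecidableEq F]

theorem ne_zero_of_quadraticChar {a : F} {ε : ℤ}
    (hε : ε = 1 ∨ ε = -1) (h : quadraticChar F a = ε) : a ≠ 0 := by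
  rintro rfl
  rw [quadraticChar_zero] at h
  omega

theorem two_mul_ncard_quadraticChar_eq {ι : Type*} [Fintype ι] (f : ι → F) {ε : ℤ}
    (hε : ε = 1 ∨ ε = -1) :
    2 * ({i | quadraticChar F (f i) = ε}.ncard : ℤ) =
      Fintype.card ι - {i | f i = 0}.ncard + ε * ∑ i, quadraticChar F (f i) := by
  classical
  have h : ∀ i, 2 * (if quadraticChar F (f i) = ε then (1 : ℤ) else 0) =
      1 - (if f i = 0 then (1 : ℤ) else 0) + ε * quadraticChar F (f i) := by
    intro i
    by_cases h0 : f i = 0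
    · rcases hε with rfl | rfl <;> simp [h0]
    · rcases quadraticChar_dichotomy h0 with h1 | h1 <;> rcases hε with rfl | rfl <;>
        simp [h0, h1]
  have hs := Finset.sum_congr rfl fun i (_ : i ∈ Finset.univ) => h i
  rw [← Finset.mul_sum, Finset.sum_add_distrib, Finset.sum_sub_distrib, ← Finset.mul_sum] at hs
  simp only [Finset.sum_boole, Finset.sum_const, Finset.card_univ, nsmul_eq_mul, mul_one] at hs
  simpa [Set.ncard_eq_toFinset_card'] using hs

theorem ncard_sq_eq (hF : ringChar F ≠ 2) (a : F) :
    ({u : F | u ^ 2 = a}.ncard : ℤ) = quadraticChar F a + 1 := by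
  rw [← quadraticChar_card_sqrts hF a, Set.ncard_eq_toFinset_card']

/-- The pairs `(u, y)` with `y² = u² - δ` are counted fibrewise by `1 + χ(u² - δ)`, and through
`(u - y)(u + y) = δ` by the `q - 1` units of the field. -/
theorem sum_quadraticChar_sq_sub (hF : ringChar F ≠ 2) {δ : F} (hδ : δ ≠ 0) :
    ∑ u, quadraticChar F (u ^ 2 - δ) = -1 := by
  have h2 : (2 : F) ≠ 0 := Ring.two_ne_zero hF
  have hfib : ∑ u, (quadraticChar F (u ^ 2 - δ) + 1) =
      (Fintype.card {p : F × F // p.2 ^ 2 = p.1 ^ 2 - δ} : ℤ) := by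
    have e : {p : F × F // p.2 ^ 2 = p.1 ^ 2 - δ} ≃ Σ u : F, {y : F // y ^ 2 = u ^ 2 - δ} :=
      { toFun := fun p => ⟨p.1.1, p.1.2, p.2⟩
        invFun := fun p => ⟨(p.1, p.2.1), p.2.2⟩
        left_inv := fun _ => rfl
        right_inv := fun _ => rfl }
    rw [Fintype.card_congr e, Fintype.card_sigma, Nat.cast_sum]
    refine Finset.sum_congr rfl fun u _ => ?_
    rw [← quadraticChar_card_sqrts hF, Set.toFinset_card]
    rfl
  have hunits : Fintype.card {p : F × F // p.2 ^ 2 = p.1 ^ 2 - δ} = Fintype.card F - 1 := by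
    rw [← Fintype.card_units]
    refine Fintype.card_congr
      { toFun := fun p => Units.mk0 (p.1.1 - p.1.2) fun h => hδ ?_
        invFun := fun w => ⟨((w + δ / w) / 2, (δ / w - w) / 2), ?_⟩
        left_inv := ?_
        right_inv := ?_ }
    · linear_combination p.2 + (p.1.1 + p.1.2) * h
    · have := w.ne_zero
      simp only
      field_simp
      ring
    · rintro ⟨⟨u, y⟩, h⟩
      have hw : u - y ≠ 0 := fun h' => hδ (by simp only at h; linear_combination h + (u + y) * h')
      have hd : δ / (u - y) = u + y := by
        rw [div_eq_iff hw]
        simp only at h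
        linear_combination h
      simp only [Units.val_mk0, hd, Subtype.mk.injEq, Prod.mk.injEq]
      constructor <;> field_simp <;> ring
    · intro w
      ext
      simp only [Units.val_mk0]
      field_simp
      ring
  rw [Finset.sum_add_distrib, hunits, Nat.cast_sub Fintype.card_pos] at hfib
  simp only [Finset.sum_const, Finset.card_univ, nsmul_eq_mul, mul_one] at hfib
  push_cast at hfib
  linarith

theorem two_mul_ncard_quadraticChar_sq_sub (hF : ringChar F ≠ 2) {δ : F} (hδ : δ ≠ 0) {ε : ℤ}
    (hε : ε = 1 ∨ ε = -1) :
    2 * ({u : F | quadraticChar F (u ^ 2 - δ) = ε}.ncard : ℤ) =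
      Fintype.card F - 1 - quadraticChar F δ - ε := by
  rw [two_mul_ncard_quadraticChar_eq (fun u : F => u ^ 2 - δ) hε, sum_quadraticChar_sq_sub hF hδ]
  simp only [sub_eq_zero]
  rw [ncard_sq_eq hF]
  ring

theorem ncard_formVal_eq_zero (hF : ringChar F ≠ 2) {a b c : F} (h : b ^ 2 - 4 * a * c ≠ 0) :
    ({s | formVal a b c s = 0}.ncard : ℤ) = 1 + quadraticChar F (b ^ 2 - 4 * a * c) := by
  have h2 : (2 : F) ≠ 0 := Ring.two_ne_zero hF
  have h4 : (4 : F) ≠ 0 := by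
    have := mul_ne_zero h2 h2
    norm_num at this
    exact this
  rw [ncard_option fun s => formVal a b c s = 0]
  by_cases ha : a = 0
  · subst ha
    have hb : b ≠ 0 := by rintro rfl; simp at h
    simp only [formVal, zero_mul, zero_add, mul_zero, sub_zero, if_true]
    rw [ncard_preimage_of_bijective (affine_bijective c hb) (fun y => y = 0),
      quadraticChar_sq_one' hb]
    simp
  · have : ∀ t, formVal a b c (some t) = 0 ↔ (2 * a * t + b) ^ 2 = b ^ 2 - 4 * a * c := by
      intro t
      rw [← sub_eq_zero (a := (2 * a * t + b) ^ 2), ← four_mul_formVal_some]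
      simp [h4, ha]
    simp only [this]
    rw [ncard_preimage_of_bijective (affine_bijective b (mul_ne_zero h2 ha))
      (fun u => u ^ 2 = b ^ 2 - 4 * a * c), Nat.cast_add, ncard_sq_eq hF]
    simp [formVal, ha, add_comm]

theorem sum_quadraticChar_formVal (hF : ringChar F ≠ 2) {a b c : F}
    (h : b ^ 2 - 4 * a * c ≠ 0) : ∑ s, quadraticChar F (formVal a b c s) = 0 := by
  have h2 : (2 : F) ≠ 0 := Ring.two_ne_zero hF
  rw [Fintype.sum_option]
  by_cases ha : a = 0
  · subst ha
    have hb : b ≠ 0 := by rintro rfl; simp at h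
    simp only [formVal, zero_mul, zero_add]
    rw [(affine_bijective c hb).sum_comp (fun y => quadraticChar F y), quadraticChar_sum_zero hF]
    simp
  · have hχ : quadraticChar F a * ∑ t, quadraticChar F (formVal a b c (some t)) = -1 := by
      rw [← sum_quadraticChar_sq_sub hF h,
        ← (affine_bijective b (mul_ne_zero h2 ha)).sum_comp
          (fun u => quadraticChar F (u ^ 2 - (b ^ 2 - 4 * a * c))), Finset.mul_sum]
      refine Finset.sum_congr rfl fun t _ => ?_
      rw [← four_mul_formVal_some, map_mul, map_mul, show (4 : F) = 2 ^ 2 by norm_num,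
        quadraticChar_sq_one' h2, one_mul]
    have h1 := quadraticChar_sq_one ha
    simp only [formVal] at hχ ⊢
    linear_combination quadraticChar F a * hχ - (∑ t, quadraticChar F (a * t ^ 2 + b * t + c)) * h1

/-- A binary quadratic form with nonzero discriminant takes square and nonsquare values equally
often on the projective line. -/
theorem two_mul_ncard_quadraticChar_formVal (hF : ringChar F ≠ 2) {a b c : F}
    (h : b ^ 2 - 4 * a * c ≠ 0) {ε : ℤ} (hε : ε = 1 ∨ ε = -1) :
    2 * ({s | quadraticChar F (formVal a b c s) = ε}.ncard : ℤ) =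
      Fintype.card F - quadraticChar F (b ^ 2 - 4 * a * c) := by
  rw [two_mul_ncard_quadraticChar_eq _ hε, sum_quadraticChar_formVal hF h,
    ncard_formVal_eq_zero hF h, Fintype.card_option]
  push_cast
  ring

end CharacterSums

/-! ### Points, osculating planes and the Hessian form -/

section Points

variable {F : Type*} [Field F]

theorem mk_mem_pointsOn {v : Fin 4 → F} (hv : v ≠ 0) (l : Submodule F (Fin 4 → F)) :
    Projectivization.mk F v hv ∈ pointsOn l ↔ v ∈ l := by
  simp [pointsOn]

theorem cubicPoint_mem_pointsOn (s : Option F) (l : Submodule F (Fin 4 → F)) :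
    cubicPoint s ∈ pointsOn l ↔ cubicVec s ∈ l := mk_mem_pointsOn _ l

theorem mk_mem_cubic {v : Fin 4 → F} (hv : v ≠ 0) :
    Projectivization.mk F v hv ∈ cubic F ↔ ∃ s, ∃ c : F, v = c • cubicVec s := by
  simp only [cubic, Set.mem_range, cubicPoint, Projectivization.mk_eq_mk_iff']
  constructor
  · rintro ⟨s, a, h⟩
    refine ⟨s, a⁻¹, ?_⟩
    have ha : a ≠ 0 := by
      rintro rfl
      exact cubicVec_ne_zero s (by rw [← h, zero_smul])
    rw [← h, smul_smul, inv_mul_cancel₀ ha, one_smul]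
  · rintro ⟨s, c, h⟩
    refine ⟨s, c⁻¹, ?_⟩
    have hc : c ≠ 0 := by
      rintro rfl
      exact hv (by rw [h, zero_smul])
    rw [h, smul_smul, inv_mul_cancel₀ hc, one_smul]

theorem mem_planeOf {c v : Fin 4 → F} :
    v ∈ planeOf c ↔ c 0 * v 0 + c 1 * v 1 + c 2 * v 2 + c 3 * v 3 = 0 := by
  change c ⬝ᵥ v = 0 ↔ _
  simp [dotProduct, Fin.sum_univ_four]

/-- In characteristic `3`, the linear form defining the osculating plane at `P(s)`. -/
def osc (v : Fin 4 → F) : Option F → F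
  | none => v 3
  | some t => v 0 - t ^ 3 * v 3

/-- The Hessian form of `v`, given by the minors of the Hankel matrix with rows `v₀ v₁ v₂` and
`v₁ v₂ v₃`: for `v` on the chord joining `P(s)` and `P(t)`, its zeros are `s` and `t`. -/
def hess (v : Fin 4 → F) : Option F → F :=
  formVal (v 2 ^ 2 - v 1 * v 3) (v 0 * v 3 - v 1 * v 2) (v 1 ^ 2 - v 0 * v 2)

/-- The discriminant of the Hessian form. -/
def disc (v : Fin 4 → F) : F :=
  (v 0 * v 3 - v 1 * v 2) ^ 2 - 4 * (v 2 ^ 2 - v 1 * v 3) * (v 1 ^ 2 - v 0 * v 2)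

theorem hess_none (v : Fin 4 → F) : hess v none = v 2 ^ 2 - v 1 * v 3 := rfl

theorem hess_some (v : Fin 4 → F) (t : F) : hess v (some t) =
    (v 2 ^ 2 - v 1 * v 3) * t ^ 2 + (v 0 * v 3 - v 1 * v 2) * t + (v 1 ^ 2 - v 0 * v 2) := rfl

theorem osc_none (v : Fin 4 → F) : osc v none = v 3 := rfl

theorem osc_some (v : Fin 4 → F) (t : F) : osc v (some t) = v 0 - t ^ 3 * v 3 := rfl

theorem cubicVec_none : cubicVec (none : Option F) = ![1, 0, 0, 0] := rfl

theorem cubicVec_some (t : F) : cubicVec (some t) = ![t ^ 3, t ^ 2, t, 1] := rfl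

theorem hess_cubicVec (s t : Option F) : hess (cubicVec s) t = 0 := by
  cases s <;> cases t <;> (simp [hess_none, hess_some, cubicVec_none, cubicVec_some]; try ring)

theorem disc_cubicVec (s : Option F) : disc (cubicVec s) = 0 := by
  cases s <;> (simp [disc, cubicVec_none, cubicVec_some]; try ring)

theorem disc_smul (c : F) (v : Fin 4 → F) : disc (c • v) = c ^ 4 * disc v := by
  simp only [disc, Pi.smul_apply, smul_eq_mul]
  ring

theorem mk_notMem_cubic_of_disc_ne_zero {v : Fin 4 → F} (hv : v ≠ 0) (h : disc v ≠ 0) :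
    Projectivization.mk F v hv ∉ cubic F := by
  rw [mk_mem_cubic]
  rintro ⟨s, c, rfl⟩
  exact h (by rw [disc_smul, disc_cubicVec, mul_zero])

theorem eq_of_smul_cubicVec_eq {s t : Option F} {c : F} (h : c • cubicVec s = cubicVec t) :
    s = t := by
  have h0 := congrFun h 0
  have h2 := congrFun h 2
  have h3 := congrFun h 3
  cases s <;> cases t <;> simp_all [cubicVec_none, cubicVec_some]

theorem cubicPoint_injective : Function.Injective (cubicPoint (F := F)) := by
  intro s t h
  obtain ⟨c, hc⟩ := (Projectivization.mk_eq_mk_iff' F _ _ (cubicVec_ne_zero s)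
    (cubicVec_ne_zero t)).1 h
  exact (eq_of_smul_cubicVec_eq hc).symm

theorem osc_comb (a b : F) (w : Fin 4 → F) (s : Option F) :
    osc (a • cubicVec s + b • w) s = b * osc w s := by
  cases s <;> simp only [osc_none, osc_some, Pi.add_apply, Pi.smul_apply, smul_eq_mul] <;>
    simp [cubicVec_none, cubicVec_some]
  ring

/-- Up to squares, the Hessian form at `s` only depends on the line joining the point to
`P(s)`. -/
theorem hess_comb (a b : F) (w : Fin 4 → F) (s : Option F) :
    hess (a • cubicVec s + b • w) s = b ^ 2 * hess w s := by
  cases s <;> simp only [hess_none, hess_some, Pi.add_apply, Pi.smul_apply, smul_eq_mul] <;>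
    simp [cubicVec_none, cubicVec_some] <;> ring

end Points

section CharThree

variable {F : Type*} [Field F] [CharP F 3]

theorem three_eq_zero : (3 : F) = 0 := by
  exact_mod_cast CharP.cast_eq_zero F 3

theorem mem_oscPlane {v : Fin 4 → F} {s : Option F} : v ∈ oscPlane s ↔ osc v s = 0 := by
  have h3 : (3 : F) = 0 := three_eq_zero
  cases s with
  | none => simp [oscPlane, mem_planeOf, osc_none]
  | some t =>
    simp only [oscPlane, mem_planeOf, osc_some]
    simp [h3, sub_eq_add_neg]

theorem cube_injective {s t : F} (h : s ^ 3 = t ^ 3) : s = t :=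
  frobenius_inj F 3 h

theorem osc_cubicVec_eq_zero {s t : Option F} : osc (cubicVec s) t = 0 ↔ s = t := by
  cases s <;> cases t <;> simp [osc_none, osc_some, cubicVec_none, cubicVec_some, sub_eq_zero]
  exact ⟨fun h => cube_injective h, fun h => by rw [h]⟩

/-- The syzygy behind the counts on a line: along a line through `P(s)` both `osc` and `hess` at `s`
are constant, so there the discriminant is a square minus a constant. On the osculating plane it
says that `hess v s` cubed is a square. -/
theorem osc_sq_mul_disc (v : Fin 4 → F) (s : F) :
    osc v (some s) ^ 2 * disc v =
      (v 3 * osc v (some s) ^ 2 - (v 1 + s * v 2 + s ^ 2 * v 3) ^ 3) ^ 2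
        - hess v (some s) ^ 3 := by
  have h3 : (3 : F) = 0 := three_eq_zero
  simp only [osc_some, disc, hess_some]
  generalize v 0 = x0, v 1 = x1, v 2 = x2, v 3 = x3
  grind

theorem osc_sq_mul_disc_none (v : Fin 4 → F) :
    osc v none ^ 2 * disc v = (v 0 * osc v none ^ 2 - v 2 ^ 3) ^ 2 - hess v none ^ 3 := by
  have h3 : (3 : F) = 0 := three_eq_zero
  simp only [osc_none, disc, hess_none]
  generalize v 0 = x0, v 1 = x1, v 2 = x2, v 3 = x3
  grind

end CharThree

/-! ### The lines meeting the cubic in one point outside the osculating planes -/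

section Lines

variable {F : Type*} [Field F]

theorem isLine_span_pair {v w : Fin 4 → F} (hv : v ≠ 0) (h : ∀ c : F, c • v ≠ w) :
    IsLine (Submodule.span F {v, w}) := by
  have hli : LinearIndependent F ![v, w] := (LinearIndependent.pair_iff' hv).2 h
  have := finrank_span_eq_card hli
  rwa [Matrix.range_cons_cons_empty, Fintype.card_fin] at this

theorem span_pair_eq_of_isLine {l : Submodule F (Fin 4 → F)} (hl : IsLine l) {v w : Fin 4 → F}
    (hv : v ≠ 0) (h : ∀ c : F, c • v ≠ w) (hvl : v ∈ l) (hwl : w ∈ l) :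
    l = Submodule.span F {v, w} := by
  symm
  apply Submodule.eq_of_le_of_finrank_eq
  · rw [Submodule.span_le]
    rintro x (rfl | rfl) <;> assumption
  · rw [isLine_span_pair hv h, hl]

theorem exists_span_pair_of_isLine {l : Submodule F (Fin 4 → F)} (hl : IsLine l) {v : Fin 4 → F}
    (hv : v ≠ 0) (hvl : v ∈ l) : ∃ w, l = Submodule.span F {v, w} := by
  have hlt : Submodule.span F {v} < l := by
    refine lt_of_le_of_ne (by simpa using hvl) fun h => ?_
    have h1 := finrank_span_singleton (K := F) hv
    rw [h, hl] at h1
    omega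
  obtain ⟨w, hwl, hw⟩ := SetLike.exists_of_lt hlt
  exact ⟨w, span_pair_eq_of_isLine hl hv
    (fun c hc => hw (Submodule.mem_span_singleton.2 ⟨c, hc⟩)) hvl hwl⟩

theorem cubicVec_mem_span (s : Option F) (v : Fin 4 → F) :
    cubicVec s ∈ Submodule.span F {cubicVec s, v} := Submodule.subset_span (by simp)

theorem mem_span_cubicVec_right (s : Option F) (v : Fin 4 → F) :
    v ∈ Submodule.span F {cubicVec s, v} := Submodule.subset_span (by simp)

theorem isLine_span_cubicVec {s : Option F} {w : Fin 4 → F} (ho : osc w s ≠ 0) :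
    IsLine (Submodule.span F {cubicVec s, w}) := by
  refine isLine_span_pair (cubicVec_ne_zero s) fun c hc => ho ?_
  have := osc_comb c 0 w s
  rwa [zero_smul, add_zero, hc, zero_mul] at this

/-- The meeting point of a line with the cubic is unique as soon as the Hessian form of some point
of the line does not vanish there. -/
theorem eq_of_cubicVec_mem_span {s t : Option F} {w : Fin 4 → F} (hh : hess w s ≠ 0)
    (h : cubicVec t ∈ Submodule.span F {cubicVec s, w}) : t = s := by
  obtain ⟨a, b, hab⟩ := Submodule.mem_span_pair.1 h
  have h1 := hess_comb a b w s
  rw [hab, hess_cubicVec, eq_comm, mul_eq_zero, or_iff_left hh, pow_eq_zero_iff two_ne_zero] at h1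
  rw [h1, zero_smul, add_zero] at hab
  exact (eq_of_smul_cubicVec_eq hab).symm

/-- The `UnΓ`-lines on which the Hessian form, evaluated at the meeting point with the cubic, has
quadratic character `ε`. This does not depend on the chosen `v`, since `hess_comb` shows that
replacing `v` changes the value by a square. -/
def UnGClass (F : Type*) [Field F] [Fintype F] [DecidableEq F] (ε : ℤ) :
    Set (Submodule F (Fin 4 → F)) :=
  {l | ∃ s v, l = Submodule.span F {cubicVec s, v} ∧ osc v s ≠ 0 ∧
    quadraticChar F (hess v s) = ε}

/-- A line through the point `v` and `P(s)` can be described by `v` itself. -/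
theorem mem_UnGClass_of_mem [Fintype F] [DecidableEq F] {ε : ℤ} {l : Submodule F (Fin 4 → F)} (hl : l ∈ UnGClass F ε) {v : Fin 4 → F} (hv : v ∈ l)
    (hvc : ∀ s, ∀ c : F, v ≠ c • cubicVec s) :
    ∃ s, l = Submodule.span F {cubicVec s, v} ∧ osc v s ≠ 0 ∧ quadraticChar F (hess v s) = ε := by
  obtain ⟨s, w, rfl, ho, hh⟩ := hl
  obtain ⟨a, b, rfl⟩ := Submodule.mem_span_pair.1 hv
  have hb : b ≠ 0 := by
    rintro rfl
    exact hvc s a (by simp)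
  have ho' : osc (a • cubicVec s + b • w) s ≠ 0 := by
    rw [osc_comb]
    exact mul_ne_zero hb ho
  refine ⟨s, ?_, ho', ?_⟩
  · refine span_pair_eq_of_isLine (isLine_span_cubicVec ho) (cubicVec_ne_zero s)
      (fun c hc => hvc s c hc.symm) (cubicVec_mem_span s w) hv
  · rw [hess_comb, map_mul, quadraticChar_sq_one' hb, one_mul, hh]

end Lines

section CharThree

variable {F : Type*} [Field F] [CharP F 3]

/-- A point with vanishing Hessian form at `s` lies on a line joining `P(s)` to another point of
the cubic. -/
theorem exists_cubicVec_of_hess_eq_zero {w : Fin 4 → F} {s : Option F} (ho : osc w s ≠ 0)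
    (hh : hess w s = 0) :
    ∃ t ≠ s, ∃ a b : F, b ≠ 0 ∧ w = a • cubicVec s + b • cubicVec t := by
  cases s with
  | none =>
    rw [osc_none] at ho
    rw [hess_none] at hh
    refine ⟨some (w 2 / w 3), by simp, w 0 - w 3 * (w 2 / w 3) ^ 3, w 3, ho, ?_⟩
    ext i
    fin_cases i <;> simp [cubicVec_none, cubicVec_some] <;> field_simp
    linear_combination -hh
  | some s =>
    rw [osc_some] at ho
    rw [hess_some] at hh
    have h3 : (3 : F) = 0 := three_eq_zero
    -- `(o, y, w 2 - s * w 3, w 3)` are the coordinates after the translation `t ↦ t - s`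
    obtain ⟨o, hw0⟩ : ∃ o, o = w 0 - s ^ 3 * w 3 := ⟨_, rfl⟩
    obtain ⟨y, hy⟩ : ∃ y, y = w 1 - 2 * s * w 2 + s ^ 2 * w 3 := ⟨_, rfl⟩
    rw [← hw0] at ho
    have hyy : y ^ 2 = o * (w 2 - s * w 3) := by
      generalize w 0 = x0, w 1 = x1, w 2 = x2, w 3 = x3 at *
      grind
    by_cases hy0 : y = 0
    · have h2 : w 2 = s * w 3 := by
        rw [hy0, zero_pow two_ne_zero, eq_comm, mul_eq_zero, or_iff_right ho, sub_eq_zero] at hyy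
        exact hyy
      refine ⟨none, by simp, w 3, o, ho, ?_⟩
      ext i
      fin_cases i <;> simp [cubicVec_none, cubicVec_some]
      · linear_combination -hw0
      · linear_combination hy0 - hy + 2 * s * h2
      · linear_combination h2
    · refine ⟨some (s + o / y), by simp [ho, hy0], w 3 - y ^ 3 / o ^ 2, y ^ 3 / o ^ 2,
        by positivity, ?_⟩
      have h2 : w 2 = s * w 3 + y ^ 2 / o := by
        field_simp
        linear_combination -hyy
      have h1 : w 1 = y + 2 * s * w 2 - s ^ 2 * w 3 := by linear_combination -hy
      have h0 : w 0 = o + s ^ 3 * w 3 := by linear_combination -hw0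
      ext i
      fin_cases i <;> simp [cubicVec_some]
      · rw [h0]
        field_simp
        linear_combination -(o * s ^ 2 * y ^ 2 + o ^ 2 * s * y) * h3
      · rw [h1, h2]
        field_simp
        ring
      · rw [h2]
        field_simp
        ring

/-- The `UnΓ`-condition on a line through `P(s)`: `osc` keeps it out of the osculating plane at `P(s)`,
the only one through `P(s)`, and `hess` keeps it away from the other points of the cubic. -/
theorem mem_UnGLines_iff {l : Submodule F (Fin 4 → F)} :
    l ∈ UnGLines F ↔
      ∃ s v, l = Submodule.span F {cubicVec s, v} ∧ osc v s ≠ 0 ∧ hess v s ≠ 0 := by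
  constructor
  · rintro ⟨hl, hc, hosc⟩
    obtain ⟨p, hp⟩ := Set.ncard_eq_one.1 hc
    obtain ⟨⟨s, rfl⟩, hs⟩ : p ∈ cubic F ∩ pointsOn l := by simp [hp]
    rw [cubicPoint_mem_pointsOn] at hs
    obtain ⟨w, rfl⟩ := exists_span_pair_of_isLine hl (cubicVec_ne_zero s) hs
    have ho : osc w s ≠ 0 := by
      intro ho
      refine hosc (oscPlane s) ⟨s, rfl⟩ ?_
      rw [Submodule.span_le]
      rintro x (rfl | rfl)
      · exact mem_oscPlane.2 (osc_cubicVec_eq_zero.2 rfl)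
      · exact mem_oscPlane.2 ho
    refine ⟨s, w, rfl, ho, fun hh => ?_⟩
    obtain ⟨t, hts, a, b, hb, hw⟩ := exists_cubicVec_of_hess_eq_zero ho hh
    have ht : cubicVec t ∈ Submodule.span F {cubicVec s, w} := by
      refine Submodule.mem_span_pair.2 ⟨-(b⁻¹ * a), b⁻¹, ?_⟩
      rw [hw, smul_add, smul_smul, smul_smul, inv_mul_cancel₀ hb, one_smul, ← add_assoc,
        ← add_smul, neg_add_cancel, zero_smul, zero_add]
    have : cubicPoint t ∈ cubic F ∩ pointsOn (Submodule.span F {cubicVec s, w}) :=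
      ⟨⟨t, rfl⟩, (cubicPoint_mem_pointsOn _ _).2 ht⟩
    rw [hp, Set.mem_singleton_iff] at this
    exact hts (cubicPoint_injective this)
  · rintro ⟨s, w, rfl, ho, hh⟩
    refine ⟨isLine_span_cubicVec ho, Set.ncard_eq_one.2 ⟨cubicPoint s, ?_⟩, ?_⟩
    · ext p
      simp only [Set.mem_inter_iff, Set.mem_singleton_iff]
      constructor
      · rintro ⟨⟨t, rfl⟩, ht⟩
        rw [eq_of_cubicVec_mem_span hh ((cubicPoint_mem_pointsOn _ _).1 ht)]
      · rintro rfl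
        exact ⟨⟨s, rfl⟩, (cubicPoint_mem_pointsOn _ _).2 (cubicVec_mem_span s w)⟩
    · rintro _ ⟨t, rfl⟩ hle
      have hst := osc_cubicVec_eq_zero.1 (mem_oscPlane.1 (hle (cubicVec_mem_span s w)))
      subst hst
      exact ho (mem_oscPlane.1 (hle (mem_span_cubicVec_right s w)))

theorem UnGClass_union [Fintype F] [DecidableEq F] :
    UnGClass F (-1) ∪ UnGClass F 1 = UnGLines F := by
  ext l
  rw [mem_UnGLines_iff]
  constructor
  · rintro (⟨s, v, hl, ho, hh⟩ | ⟨s, v, hl, ho, hh⟩)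
    · exact ⟨s, v, hl, ho, ne_zero_of_quadraticChar (by simp) hh⟩
    · exact ⟨s, v, hl, ho, ne_zero_of_quadraticChar (by simp) hh⟩
  · rintro ⟨s, v, hl, ho, hh⟩
    rcases quadraticChar_dichotomy hh with h | h
    · exact Or.inr ⟨s, v, hl, ho, h⟩
    · exact Or.inl ⟨s, v, hl, ho, h⟩

end CharThree

/-! ### Classification of the points by the discriminant of the Hessian form -/

section Classification

variable {F : Type*} [Field F]

/-- The two Hankel relations: a point is annihilated by its Hessian form. -/
theorem hankel_relations (v : Fin 4 → F) :
    (v 2 ^ 2 - v 1 * v 3) * v 0 + (v 0 * v 3 - v 1 * v 2) * v 1 + (v 1 ^ 2 - v 0 * v 2) * v 2 = 0 ∧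
    (v 2 ^ 2 - v 1 * v 3) * v 1 + (v 0 * v 3 - v 1 * v 2) * v 2 + (v 1 ^ 2 - v 0 * v 2) * v 3 = 0 :=
  ⟨by ring, by ring⟩

theorem disc_chord (a b t u : F) :
    disc (a • cubicVec (some t) + b • cubicVec (some u)) = (a * b * (t - u) ^ 3) ^ 2 := by
  simp [disc, cubicVec_some]
  ring

theorem disc_chord_none (a b u : F) :
    disc (a • cubicVec none + b • cubicVec (some u)) = (a * b) ^ 2 := by
  simp [disc, cubicVec_none, cubicVec_some]
  ring

/-- If the Hessian form of `v` has distinct zeros `s` and `t`, both finite, then `v` is on the chord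
joining `P(s)` and `P(t)`. -/
theorem eq_chord_of_roots {v : Fin 4 → F} {a b c s t : F} (ha : a ≠ 0) (hst : s ≠ t)
    (hb : b = -a * (s + t)) (hc : c = a * (s * t))
    (h₁ : a * v 0 + b * v 1 + c * v 2 = 0) (h₂ : a * v 1 + b * v 2 + c * v 3 = 0) :
    v = ((v 2 - t * v 3) / (s - t)) • cubicVec (some s) +
      ((s * v 3 - v 2) / (s - t)) • cubicVec (some t) := by
  have hst' : s - t ≠ 0 := sub_ne_zero.2 hst
  have e₁ : v 1 = (s + t) * v 2 - s * t * v 3 := by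
    apply mul_left_cancel₀ ha
    rw [hb, hc] at h₂
    linear_combination h₂
  have e₀ : v 0 = (s + t) * v 1 - s * t * v 2 := by
    apply mul_left_cancel₀ ha
    rw [hb, hc] at h₁
    linear_combination h₁
  rw [e₁] at e₀
  ext i
  fin_cases i <;> simp [cubicVec_some]
  · rw [e₀]; field_simp; ring
  · rw [e₁]; field_simp; ring
  · field_simp; ring
  · field_simp; ring

theorem exists_chord_of_disc_eq_sq (h2 : (2 : F) ≠ 0) {v : Fin 4 → F} {y : F} (hy : y ≠ 0)
    (hd : disc v = y ^ 2) :
    ∃ s t : Option F, s ≠ t ∧ v ∈ Submodule.span F {cubicVec s, cubicVec t} := by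
  obtain ⟨h₁, h₂⟩ := hankel_relations v
  simp only [disc] at hd
  generalize v 2 ^ 2 - v 1 * v 3 = a at *
  generalize v 0 * v 3 - v 1 * v 2 = b at *
  generalize v 1 ^ 2 - v 0 * v 2 = c at *
  by_cases ha : a = 0
  · subst ha
    have hb : b ≠ 0 := by
      rintro rfl
      exact hy (by simpa using hd.symm)
    have e₂ : v 2 = -c / b * v 3 := by
      field_simp
      linear_combination h₂
    have e₁ : v 1 = -c / b * v 2 := by
      field_simp
      linear_combination h₁
    refine ⟨none, some (-c / b), by simp, Submodule.mem_span_pair.2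
      ⟨v 0 - v 3 * (-c / b) ^ 3, v 3, ?_⟩⟩
    rw [e₂] at e₁
    ext i
    fin_cases i <;> simp [cubicVec_none, cubicVec_some]
    · rw [e₁]; ring
    · rw [e₂]; ring
  · have hst : (-b + y) / (2 * a) ≠ (-b - y) / (2 * a) := by
      intro h
      rw [div_left_inj' (mul_ne_zero h2 ha)] at h
      have : 2 * y = 0 := by linear_combination h
      simp [h2, hy] at this
    refine ⟨some ((-b + y) / (2 * a)), some ((-b - y) / (2 * a)), by simpa using hst, ?_⟩
    rw [eq_chord_of_roots ha hst (by field_simp; ring) (by field_simp; linear_combination -hd) h₁ h₂]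
    exact Submodule.mem_span_pair.2 ⟨_, _, rfl⟩

theorem cubicVec_smul_ne {s t : Option F} (hst : s ≠ t) (c : F) : c • cubicVec s ≠ cubicVec t :=
  fun h => hst (eq_of_smul_cubicVec_eq h)

theorem mk_mem_RCPoints [Fintype F] [DecidableEq F] (h2 : (2 : F) ≠ 0) {v : Fin 4 → F}
    (hv : v ≠ 0) :
    Projectivization.mk F v hv ∈ RCPoints F ↔ quadraticChar F (disc v) = 1 := by
  constructor
  · rintro ⟨hc, l, ⟨hl, s, t, hst, hs, ht⟩, hp⟩
    rw [cubicPoint_mem_pointsOn] at hs ht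
    rw [mk_mem_pointsOn,
      span_pair_eq_of_isLine hl (cubicVec_ne_zero s) (cubicVec_smul_ne hst) hs ht] at hp
    obtain ⟨a, b, rfl⟩ := Submodule.mem_span_pair.1 hp
    rw [mk_mem_cubic] at hc
    have ha : a ≠ 0 := by
      rintro rfl
      exact hc ⟨t, b, by simp⟩
    have hb : b ≠ 0 := by
      rintro rfl
      exact hc ⟨s, a, by simp⟩
    cases s with
    | none =>
      cases t with
      | none => exact absurd rfl hst
      | some u =>
        rw [disc_chord_none]
        exact quadraticChar_sq_one' (mul_ne_zero ha hb)
    | some u =>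
      cases t with
      | none =>
        rw [add_comm, disc_chord_none]
        exact quadraticChar_sq_one' (mul_ne_zero hb ha)
      | some w =>
        rw [disc_chord]
        have : u - w ≠ 0 := sub_ne_zero.2 fun h => hst (by rw [h])
        exact quadraticChar_sq_one' (by positivity)
  · intro h
    have h0 : disc v ≠ 0 := ne_zero_of_quadraticChar (Or.inl rfl) h
    obtain ⟨y, hy⟩ := (quadraticChar_one_iff_isSquare h0).1 h
    have hy0 : y ≠ 0 := by
      rintro rfl
      exact h0 (by simpa using hy)
    obtain ⟨s, t, hst, hmem⟩ := exists_chord_of_disc_eq_sq h2 hy0 (hy.trans (sq y).symm)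
    exact ⟨mk_notMem_cubic_of_disc_ne_zero hv h0, _,
      ⟨isLine_span_pair (cubicVec_ne_zero s) (cubicVec_smul_ne hst), s, t, hst,
        (cubicPoint_mem_pointsOn _ _).2 (Submodule.subset_span (by simp)),
        (cubicPoint_mem_pointsOn _ _).2 (Submodule.subset_span (by simp))⟩,
      (mk_mem_pointsOn _ _).2 hmem⟩

section Conjugate

variable {K : Type*} [Field K] [Algebra F K]

theorem mem_range_of_smul_cubicVec {v : Fin 4 → F} (hv : v ≠ 0) {c τ : K}
    (h : (fun i => algebraMap F K (v i)) = c • affineVec τ) : τ ∈ Set.range (algebraMap F K) := by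
  have e3 : algebraMap F K (v 3) = c := by simpa [affineVec] using congrFun h 3
  have e2 : algebraMap F K (v 2) = c * τ := by simpa [affineVec] using congrFun h 2
  have hc : c ≠ 0 := by
    rintro rfl
    rw [zero_smul] at h
    exact hv (funext fun i => by simpa using congrFun h i)
  refine ⟨v 2 / v 3, ?_⟩
  rw [map_div₀, e2, e3]
  field_simp

/-- A conjugate chord carries no point with square discriminant: otherwise the quadratic formula
would bring the parameter `t` down to the base field. -/
theorem not_isSquare_disc_of_mem_conjugate_chord (h2 : (2 : F) ≠ 0) {v : Fin 4 → F} (hv : v ≠ 0)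
    {t t' : K} (ht : t ∉ Set.range (algebraMap F K)) (ht' : t' ∉ Set.range (algebraMap F K))
    {x y : K} (h : (fun i => algebraMap F K (v i)) = x • affineVec t + y • affineVec t') :
    ¬ IsSquare (disc v) := by
  rintro ⟨z, hz⟩
  have e3 : algebraMap F K (v 3) = x + y := by simpa [affineVec] using congrFun h 3
  have e2 : algebraMap F K (v 2) = x * t + y * t' := by simpa [affineVec] using congrFun h 2
  have e1 : algebraMap F K (v 1) = x * t ^ 2 + y * t' ^ 2 := by
    simpa [affineVec] using congrFun h 1
  have e0 : algebraMap F K (v 0) = x * t ^ 3 + y * t' ^ 3 := by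
    simpa [affineVec] using congrFun h 0
  simp only [disc] at hz
  have hA : algebraMap F K (v 2 ^ 2 - v 1 * v 3) = -(x * y * (t - t') ^ 2) := by
    simp only [map_sub, map_pow, map_mul, e1, e2, e3]
    ring
  have hB : algebraMap F K (v 0 * v 3 - v 1 * v 2) = x * y * (t - t') ^ 2 * (t + t') := by
    simp only [map_sub, map_mul, e0, e1, e2, e3]
    ring
  have hC : algebraMap F K (v 1 ^ 2 - v 0 * v 2) = -(x * y * (t - t') ^ 2 * (t * t')) := by
    simp only [map_sub, map_pow, map_mul, e0, e1, e2]
    ring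
  generalize v 2 ^ 2 - v 1 * v 3 = a at *
  generalize v 0 * v 3 - v 1 * v 2 = b at *
  generalize v 1 ^ 2 - v 0 * v 2 = c at *
  by_cases ha : a = 0
  · rw [ha, map_zero, eq_comm, neg_eq_zero, mul_eq_zero, mul_eq_zero,
      pow_eq_zero_iff two_ne_zero, sub_eq_zero] at hA
    rcases hA with (rfl | rfl) | rfl
    · exact ht' (mem_range_of_smul_cubicVec hv (c := y) (by simpa using h))
    · exact ht (mem_range_of_smul_cubicVec hv (c := x) (by simpa using h))
    · exact ht (mem_range_of_smul_cubicVec hv (c := x + y) (by rw [h, add_smul]))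
  · have hsq : (algebraMap F K (2 * a) * t + algebraMap F K b) ^ 2 = algebraMap F K z ^ 2 := by
      rw [← map_pow, sq z, ← hz]
      simp only [map_sub, map_pow, map_mul, map_ofNat, hA, hB, hC]
      ring
    have h2a : algebraMap F K (2 * a) ≠ 0 := by
      rw [map_ne_zero]
      exact mul_ne_zero h2 ha
    rcases sq_eq_sq_iff_eq_or_eq_neg.1 hsq with h | h
    · refine ht ⟨(z - b) / (2 * a), ?_⟩
      rw [map_div₀, div_eq_iff h2a, map_sub]
      linear_combination -h
    · refine ht ⟨(-z - b) / (2 * a), ?_⟩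
      rw [map_div₀, div_eq_iff h2a, map_sub, map_neg]
      linear_combination -h

end Conjugate

end Classification

/-! ### Imaginary chords -/

section Imaginary

variable {F : Type*} [Field F] [Fintype F]

/-- A square root of a nonsquare is negated by the Frobenius map of the base field. -/
theorem sqrt_pow_card_of_not_isSquare {K : Type*} [Field K] [Algebra F K] (hF : ringChar F ≠ 2)
    {d : F} (hd : ¬ IsSquare d) {z : K} (hz : z ^ 2 = algebraMap F K d) :
    z ^ Fintype.card F = -z := by
  have hd0 : d ≠ 0 := by
    rintro rfl
    exact hd IsSquare.zero
  have h1 : d ^ (Fintype.card F / 2) = -1 :=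
    (FiniteField.pow_dichotomy hF hd0).resolve_left
      fun h => hd ((FiniteField.isSquare_iff hF hd0).2 h)
  have hq : Fintype.card F = 2 * (Fintype.card F / 2) + 1 := by
    have := FiniteField.odd_card_of_char_ne_two hF
    omega
  rw [hq, pow_succ, pow_mul, hz, ← map_pow, h1]
  simp

/-- Over an extension field containing a square root of the nonsquare discriminant, the two zeros of
the Hessian form are conjugate and span the solution space of the Hankel relations. -/
theorem exists_conjugate_chord {K : Type*} [Field K] [Algebra F K] (hF : ringChar F ≠ 2)
    {v : Fin 4 → F} (hd : ¬ IsSquare (disc v)) {z : K} (hz : z ^ 2 = algebraMap F K (disc v)) :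
    ∃ l : Submodule F (Fin 4 → F), IsLine l ∧ v ∈ l ∧
      ∃ t : K, t ∉ Set.range (algebraMap F K) ∧ t ^ (Nat.card F ^ 2) = t ∧
        Submodule.span K ((fun (v : Fin 4 → F) (i : Fin 4) => algebraMap F K (v i)) '' l) =
          Submodule.span K {affineVec t, affineVec (t ^ Nat.card F)} := by
  have h2 : (2 : F) ≠ 0 := Ring.two_ne_zero hF
  have hzq := sqrt_pow_card_of_not_isSquare hF hd hz
  have hzF : z ∉ Set.range (algebraMap F K) := by
    rintro ⟨c, rfl⟩
    rw [← map_pow] at hz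
    exact hd ⟨c, by rw [← sq, (algebraMap F K).injective hz]⟩
  obtain ⟨h₁, h₂⟩ := hankel_relations v
  simp only [disc] at hd hz
  generalize v 2 ^ 2 - v 1 * v 3 = a at *
  generalize v 0 * v 3 - v 1 * v 2 = b at *
  generalize v 1 ^ 2 - v 0 * v 2 = c at *
  have ha : a ≠ 0 := by
    rintro rfl
    exact hd ⟨b, by ring⟩
  have h2K : (2 : K) ≠ 0 := by
    rw [← map_ofNat (algebraMap F K)]
    simpa using h2
  have haK : algebraMap F K a ≠ 0 := by simpa using ha
  have hz0 : z ≠ 0 := fun h => hzF ⟨0, by rw [map_zero, h]⟩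
  simp only [map_sub, map_pow, map_mul, map_ofNat] at hz
  set α := algebraMap F K a with hα
  set β := algebraMap F K b with hβ
  set γ := algebraMap F K c with hγ
  obtain ⟨t, ht⟩ : ∃ t, t = (-β + z) / (2 * α) := ⟨_, rfl⟩
  obtain ⟨t', ht'⟩ : ∃ t', t' = (-β - z) / (2 * α) := ⟨_, rfl⟩
  have hfrob : ∀ x : K, x ^ Nat.card F = FiniteField.frobeniusAlgHom F K x := by
    intro x
    simp
  have htt' : t ^ Nat.card F = t' := by
    rw [hfrob, ht, ht']
    simp only [map_div₀, map_add, map_neg, map_mul, map_ofNat, hα, hβ, AlgHom.commutes]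
    rw [← hfrob, Nat.card_eq_fintype_card, hzq]
    ring
  have ht't : t' ^ Nat.card F = t := by
    rw [hfrob, ht, ht']
    simp only [map_div₀, map_sub, map_neg, map_mul, map_ofNat, hα, hβ, AlgHom.commutes]
    rw [← hfrob, Nat.card_eq_fintype_card, hzq]
    ring
  have hz_eq : z = 2 * α * t + β := by
    rw [ht]
    field_simp
    ring
  have hne : t - t' ≠ 0 := by
    rw [ht, ht', ← sub_div]
    have : -β + z - (-β - z) = 2 * z := by ring
    rw [this]
    positivity
  have hsum : β / α = -(t + t') := by
    rw [ht, ht']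
    field_simp
    ring
  have hprod : γ / α = t * t' := by
    rw [ht, ht']
    field_simp
    linear_combination hz
  -- a basis of the solution space of the two Hankel relations
  set e : Fin 4 → F := ![(b / a) ^ 2 - c / a, -(b / a), 1, 0] with he
  set f : Fin 4 → F := ![(b / a) * (c / a), -(c / a), 0, 1] with hf
  have he' : (fun i => algebraMap F K (e i)) =
      (t - t')⁻¹ • affineVec t + (-(t - t')⁻¹) • affineVec t' := by
    ext i
    fin_cases i <;> simp [he, affineVec, ← hα, ← hβ, ← hγ, hsum, hprod] <;> field_simp <;> ring
  have hf' : (fun i => algebraMap F K (f i)) =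
      (-(t' * (t - t')⁻¹)) • affineVec t + (t * (t - t')⁻¹) • affineVec t' := by
    ext i
    fin_cases i <;> simp [hf, affineVec, ← hα, ← hβ, ← hγ, hsum, hprod] <;> field_simp <;> ring
  have hline : IsLine (Submodule.span F {e, f}) := by
    refine isLine_span_pair (fun h => ?_) (fun x h => ?_)
    · simpa [he] using congrFun h 2
    · simpa [he, hf] using congrFun h 3
  refine ⟨Submodule.span F {e, f}, hline, ?_, t, ?_, ?_, ?_⟩
  · refine Submodule.mem_span_pair.2 ⟨v 2, v 3, ?_⟩
    have e₁ : v 1 = -(b / a) * v 2 - c / a * v 3 := by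
      field_simp
      linear_combination h₂
    have e₀ : v 0 = -(b / a) * v 1 - c / a * v 2 := by
      field_simp
      linear_combination h₁
    rw [e₁] at e₀
    ext i
    fin_cases i <;> simp [he, hf]
    · rw [e₀]; ring
    · rw [e₁]; ring
  · rintro ⟨τ, hτ⟩
    refine hzF ⟨2 * a * τ + b, ?_⟩
    rw [hz_eq, ← hτ]
    simp only [map_add, map_mul, map_ofNat, hα, hβ]
  · rw [sq, pow_mul, htt', ht't]
  · rw [htt']
    apply le_antisymm
    · rw [Submodule.span_le]
      rintro _ ⟨w, hw, rfl⟩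
      obtain ⟨x, y, rfl⟩ := Submodule.mem_span_pair.1 hw
      have : (fun i => algebraMap F K ((x • e + y • f) i)) =
          algebraMap F K x • (fun i => algebraMap F K (e i)) +
            algebraMap F K y • (fun i => algebraMap F K (f i)) := by
        ext i
        simp [Algebra.smul_def]
      simp only [SetLike.mem_coe]
      rw [this, he', hf']
      have m₁ : affineVec t ∈ Submodule.span K {affineVec t, affineVec t'} :=
        Submodule.subset_span (by simp)
      have m₂ : affineVec t' ∈ Submodule.span K {affineVec t, affineVec t'} :=
        Submodule.subset_span (by simp)
      exact add_mem
        (Submodule.smul_mem _ _ (add_mem (Submodule.smul_mem _ _ m₁) (Submodule.smul_mem _ _ m₂)))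
        (Submodule.smul_mem _ _ (add_mem (Submodule.smul_mem _ _ m₁) (Submodule.smul_mem _ _ m₂)))
    · have m₁ : (fun i => algebraMap F K (e i)) ∈ Submodule.span K
          ((fun (v : Fin 4 → F) (i : Fin 4) => algebraMap F K (v i)) ''
            (Submodule.span F {e, f} : Submodule F (Fin 4 → F))) :=
        Submodule.subset_span ⟨e, Submodule.subset_span (by simp), rfl⟩
      have m₂ : (fun i => algebraMap F K (f i)) ∈ Submodule.span K
          ((fun (v : Fin 4 → F) (i : Fin 4) => algebraMap F K (v i)) ''
            (Submodule.span F {e, f} : Submodule F (Fin 4 → F))) :=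
        Submodule.subset_span ⟨f, Submodule.subset_span (by simp), rfl⟩
      have k₁ : affineVec t = t • (fun i => algebraMap F K (e i)) +
          (fun i => algebraMap F K (f i)) := by
        rw [he', hf']
        ext i
        simp only [Pi.add_apply, Pi.smul_apply, smul_eq_mul]
        field_simp
        ring
      have k₂ : affineVec t' = t' • (fun i => algebraMap F K (e i)) +
          (fun i => algebraMap F K (f i)) := by
        rw [he', hf']
        ext i
        simp only [Pi.add_apply, Pi.smul_apply, smul_eq_mul]
        field_simp
        ring
      rw [Submodule.span_le]
      rintro x (rfl | rfl)
      · rw [k₁]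
        exact add_mem (Submodule.smul_mem _ _ m₁) m₂
      · rw [k₂]
        exact add_mem (Submodule.smul_mem _ _ m₁) m₂

theorem mk_mem_ICPoints [DecidableEq F] (hF : ringChar F ≠ 2) {v : Fin 4 → F} (hv : v ≠ 0) :
    Projectivization.mk F v hv ∈ ICPoints F ↔ quadraticChar F (disc v) = -1 := by
  have h2 : (2 : F) ≠ 0 := Ring.two_ne_zero hF
  rw [quadraticChar_neg_one_iff_not_isSquare]
  constructor
  · rintro ⟨l, ⟨hl, t, ht, htq, hspan⟩, hp⟩
    rw [mk_mem_pointsOn] at hp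
    have hmem : (fun i => algebraMap F (AlgebraicClosure F) (v i)) ∈
        Submodule.span (AlgebraicClosure F)
          {affineVec t, affineVec (t ^ Nat.card F)} := by
      rw [← hspan]
      exact Submodule.subset_span ⟨v, hp, rfl⟩
    obtain ⟨x, y, hxy⟩ := Submodule.mem_span_pair.1 hmem
    refine not_isSquare_disc_of_mem_conjugate_chord h2 hv ht (fun ⟨c, hc⟩ => ht ?_) hxy.symm
    refine ⟨c ^ Nat.card F, ?_⟩
    rw [map_pow, hc, ← pow_mul, ← sq, htq]
  · intro hd
    obtain ⟨z, hz⟩ := IsAlgClosed.exists_pow_nat_eq 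
      (algebraMap F (AlgebraicClosure F) (disc v)) two_pos
    obtain ⟨l, hl, hvl, h⟩ := exists_conjugate_chord hF hd hz
    exact ⟨l, ⟨hl, h⟩, (mk_mem_pointsOn _ _).2 hvl⟩

end Imaginary

/-! ### Tangents -/

section Tangent

variable {F : Type*} [Field F]

/-- The direction of the tangent at `P(s)`. -/
def tangentVec : Option F → (Fin 4 → F)
  | none => ![0, 1, 0, 0]
  | some t => ![3 * t ^ 2, 2 * t, 1, 0]

theorem tangent_eq_span (s : Option F) :
    tangent s = Submodule.span F {cubicVec s, tangentVec s} := by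
  cases s <;> rfl

theorem disc_tangent (a b : F) (s : Option F) : disc (a • cubicVec s + b • tangentVec s) = 0 := by
  cases s <;> simp [disc, cubicVec_none, cubicVec_some, tangentVec] <;> ring

/-- The Hessian form of a point of the tangent at `P(s)` is `b²` times the square of a linear form
whose only zero is `s`. -/
theorem exists_hess_tangent_eq_sq {a b : F} (hb : b ≠ 0) {s t : Option F} (hst : t ≠ s) :
    ∃ y ≠ 0, hess (a • cubicVec s + b • tangentVec s) t = y ^ 2 := by
  cases s with
  | none =>
    cases t with
    | none => exact absurd rfl hst
    | some t =>
      refine ⟨b, hb, ?_⟩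
      simp [hess_some, cubicVec_none, tangentVec]
  | some s =>
    cases t with
    | none =>
      refine ⟨b, hb, ?_⟩
      simp [hess_none, cubicVec_some, tangentVec]
      ring
    | some t =>
      refine ⟨b * (t - s), mul_ne_zero hb (sub_ne_zero.2 fun h => hst (by rw [h])), ?_⟩
      simp [hess_some, cubicVec_some, tangentVec]
      ring

theorem exists_tangent_of_disc_eq_zero (h2 : (2 : F) ≠ 0) {v : Fin 4 → F}
    (hc : ∀ s, ∀ c : F, v ≠ c • cubicVec s) (hd : disc v = 0) : ∃ s, v ∈ tangent s := by
  obtain ⟨h₁, h₂⟩ := hankel_relations v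
  simp only [disc] at hd
  by_cases ha : v 2 ^ 2 - v 1 * v 3 = 0
  · have hb : v 0 * v 3 - v 1 * v 2 = 0 := by
      rw [ha] at hd
      simpa using hd
    rw [ha, hb, zero_mul, zero_mul, zero_add, zero_add, mul_eq_zero] at h₁ h₂
    by_cases hcc : v 1 ^ 2 - v 0 * v 2 = 0
    · exfalso
      by_cases h3 : v 3 = 0
      · have e2 : v 2 = 0 := by simpa [h3] using ha
        have e1 : v 1 = 0 := by simpa [e2] using hcc
        refine hc none (v 0) ?_
        ext i
        fin_cases i <;> simp [cubicVec_none, e1, e2, h3]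
      · refine hc (some (v 2 / v 3)) (v 3) ?_
        have e1 : v 1 = v 2 ^ 2 / v 3 := by
          field_simp
          linear_combination -ha
        have e0 : v 0 = v 2 ^ 3 / v 3 ^ 2 := by
          have : v 0 = v 1 * v 2 / v 3 := by
            field_simp
            linear_combination hb
          rw [this, e1]
          field_simp
        ext i
        fin_cases i <;> simp [cubicVec_some, e0, e1] <;> field_simp
    · have e2 : v 2 = 0 := h₁.resolve_left hcc
      have e3 : v 3 = 0 := h₂.resolve_left hcc
      refine ⟨none, ?_⟩
      rw [tangent_eq_span]
      refine Submodule.mem_span_pair.2 ⟨v 0, v 1, ?_⟩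
      ext i
      fin_cases i <;> simp [cubicVec_none, tangentVec, e2, e3]
  · obtain ⟨s, hs⟩ : ∃ s, s = -(v 0 * v 3 - v 1 * v 2) / (2 * (v 2 ^ 2 - v 1 * v 3)) := ⟨_, rfl⟩
    refine ⟨some s, ?_⟩
    rw [tangent_eq_span]
    refine Submodule.mem_span_pair.2 ⟨v 3, v 2 - s * v 3, ?_⟩
    have hb : v 0 * v 3 - v 1 * v 2 = -2 * s * (v 2 ^ 2 - v 1 * v 3) := by
      rw [hs, div_eq_mul_inv, mul_inv]
      have hi := mul_inv_cancel₀ h2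
      have hi' := mul_inv_cancel₀ ha
      linear_combination -(v 0 * v 3 - v 1 * v 2) * (hi' + (v 2 ^ 2 - v 1 * v 3) *
        (v 2 ^ 2 - v 1 * v 3)⁻¹ * hi)
    generalize v 2 ^ 2 - v 1 * v 3 = a at *
    generalize v 0 * v 3 - v 1 * v 2 = b at *
    generalize v 1 ^ 2 - v 0 * v 2 = c at *
    have hc' : c = a * s ^ 2 := by
      have h4 : (4 : F) * a ≠ 0 := by
        have : (4 : F) = 2 * 2 := by norm_num
        rw [this]
        positivity
      apply mul_left_cancel₀ h4
      rw [hb] at hd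
      linear_combination -hd
    rw [hb, hc'] at h₁ h₂
    have e₁ : v 1 = 2 * s * v 2 - s ^ 2 * v 3 := by
      apply mul_left_cancel₀ ha
      linear_combination h₂
    have e₀ : v 0 = 2 * s * v 1 - s ^ 2 * v 2 := by
      apply mul_left_cancel₀ ha
      linear_combination h₁
    rw [e₁] at e₀
    ext i
    fin_cases i <;> simp [cubicVec_some, tangentVec]
    · rw [e₀]; ring
    · rw [e₁]; ring
    · ring

end Tangent

/-! ### Tangent points and the pencil of osculating planes -/

section TangentPoints

variable {F : Type*} [Field F] [CharP F 3]

theorem oscPlane_injective : Function.Injective (oscPlane (F := F)) := by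
  intro s t h
  have : cubicVec s ∈ oscPlane t := h ▸ mem_oscPlane.2 (osc_cubicVec_eq_zero.2 rfl)
  exact osc_cubicVec_eq_zero.1 (mem_oscPlane.1 this)

theorem ncard_oscPlanes_through {v : Fin 4 → F} (hv : v ≠ 0) :
    {π ∈ oscPlanes F | Projectivization.mk F v hv ∈ pointsOn π}.ncard =
      {s | osc v s = 0}.ncard := by
  rw [← Set.ncard_image_of_injective _ oscPlane_injective]
  congr 1
  ext π
  constructor
  · rintro ⟨⟨s, rfl⟩, h⟩
    exact ⟨s, mem_oscPlane.1 ((mk_mem_pointsOn _ _).1 h), rfl⟩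
  · rintro ⟨s, h, rfl⟩
    exact ⟨⟨s, rfl⟩, (mk_mem_pointsOn _ _).2 (mem_oscPlane.2 h)⟩

/-- The osculating planes form the pencil with axis `x₀ = x₃ = 0`; a point off the axis is on
exactly one of them, since every element has a unique cube root. -/
theorem exists_osc_eq_zero_iff [Finite F] {v : Fin 4 → F} (hv : ¬ (v 0 = 0 ∧ v 3 = 0)) :
    ∃ s₀, ∀ s, osc v s = 0 ↔ s = s₀ := by
  by_cases h3 : v 3 = 0
  · have h0 : v 0 ≠ 0 := fun h => hv ⟨h, h3⟩
    refine ⟨none, fun s => ?_⟩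
    cases s <;> simp [osc_none, osc_some, h3, h0]
  · have hsurj : Function.Surjective fun x : F => x ^ 3 :=
      Finite.surjective_of_injective fun _ _ h => cube_injective h
    obtain ⟨t, ht⟩ := hsurj (v 0 / v 3)
    simp only at ht
    have h0 : v 0 = t ^ 3 * v 3 := by
      rw [ht]
      field_simp
    refine ⟨some t, fun s => ?_⟩
    cases s with
    | none => simp [osc_none, h3]
    | some s =>
      rw [osc_some, h0, ← sub_mul, mul_eq_zero, or_iff_left h3, sub_eq_zero, Option.some_inj]
      exact ⟨fun h => (cube_injective h).symm, fun h => by rw [h]⟩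

theorem ncard_osc_eq_zero_eq_one_iff [Finite F] {v : Fin 4 → F} :
    {s | osc v s = 0}.ncard = 1 ↔ ¬ (v 0 = 0 ∧ v 3 = 0) := by
  constructor
  · rintro h ⟨h0, h3⟩
    obtain ⟨s, hs⟩ := Set.ncard_eq_one.1 h
    have hall : ∀ t, t = s := by
      intro t
      have : t ∈ {s | osc v s = 0} := by cases t <;> simp [osc_none, osc_some, h0, h3]
      rwa [hs] at this
    exact absurd ((hall none).trans (hall (some 0)).symm) (by simp)
  · intro h
    obtain ⟨s, hs⟩ := exists_osc_eq_zero_iff h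
    exact Set.ncard_eq_one.2 ⟨s, Set.ext hs⟩

theorem two_ne_zero_of_charP_three : (2 : F) ≠ 0 := by
  intro h
  have h3 : (3 : F) = 0 := three_eq_zero
  exact one_ne_zero (α := F) (by linear_combination h3 - h)

theorem mk_mem_TOPoints [Finite F] {v : Fin 4 → F} (hv : v ≠ 0) :
    Projectivization.mk F v hv ∈ TOPoints F ↔
      (∀ s, ∀ c : F, v ≠ c • cubicVec s) ∧ disc v = 0 ∧ ¬ (v 0 = 0 ∧ v 3 = 0) := by
  simp only [TOPoints, Set.mem_ofPred_eq]
  rw [ncard_oscPlanes_through, ncard_osc_eq_zero_eq_one_iff, mk_mem_cubic]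
  push Not
  simp only [mk_mem_pointsOn]
  refine and_congr_right fun hc => and_congr_left fun _ => ?_
  constructor
  · rintro ⟨s, hs⟩
    rw [tangent_eq_span] at hs
    obtain ⟨a, b, rfl⟩ := Submodule.mem_span_pair.1 hs
    exact disc_tangent a b s
  · exact exists_tangent_of_disc_eq_zero two_ne_zero_of_charP_three hc

theorem osc_tangent (a b : F) (s : Option F) : osc (a • cubicVec s + b • tangentVec s) s = 0 := by
  have h3 : (3 : F) = 0 := three_eq_zero
  cases s <;> simp [osc_none, osc_some, cubicVec_none, cubicVec_some, tangentVec, h3]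
  ring

/-- On its osculating plane the Hessian form is a square. -/
theorem exists_hess_eq_sq_of_osc_eq_zero {v : Fin 4 → F} {s : Option F} (ho : osc v s = 0) :
    ∃ y, hess v s = y ^ 2 ∧ (y = 0 → disc v = 0) := by
  have h3 : (3 : F) = 0 := three_eq_zero
  cases s with
  | none =>
    rw [osc_none] at ho
    refine ⟨v 2, by rw [hess_none, ho]; ring, fun h => ?_⟩
    simp [disc, ho, h]
  | some s =>
    rw [osc_some] at ho
    refine ⟨v 1 + s * v 2 + s ^ 2 * v 3, ?_, fun h => ?_⟩
    · rw [hess_some]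
      generalize v 0 = x0, v 1 = x1, v 2 = x2, v 3 = x3 at *
      grind
    · simp only [disc]
      generalize v 0 = x0, v 1 = x1, v 2 = x2, v 3 = x3 at *
      grind

end TangentPoints

/-! ### Numbers of lines through a point -/

section LinesThrough

variable {F : Type*} [Field F]

theorem ringChar_ne_two [CharP F 3] : ringChar F ≠ 2 := by
  rw [ringChar.eq F 3]
  norm_num

variable [Fintype F] [DecidableEq F]

theorem numLinesThrough_UnGClass {ε : ℤ} (hε : ε = 1 ∨ ε = -1) {v : Fin 4 → F} (hv : v ≠ 0)
    (hvc : ∀ s, ∀ c : F, v ≠ c • cubicVec s) :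
    numLinesThrough (UnGClass F ε) (Projectivization.mk F v hv) =
      {s | osc v s ≠ 0 ∧ quadraticChar F (hess v s) = ε}.ncard := by
  have hinj : Set.InjOn (fun s => Submodule.span F {cubicVec s, v})
      {s | osc v s ≠ 0 ∧ quadraticChar F (hess v s) = ε} := by
    rintro s - t ⟨-, ht⟩ h
    simp only at h
    exact eq_of_cubicVec_mem_span (ne_zero_of_quadraticChar hε ht)
      (h ▸ cubicVec_mem_span s v)
  rw [← hinj.ncard_image, numLinesThrough]
  congr 1
  ext l
  constructor
  · rintro ⟨hl, hp⟩
    obtain ⟨s, rfl, hs⟩ := mem_UnGClass_of_mem hl ((mk_mem_pointsOn _ _).1 hp) hvc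
    exact ⟨s, hs, rfl⟩
  · rintro ⟨s, ⟨ho, hs⟩, rfl⟩
    exact ⟨⟨s, v, rfl, ho, hs⟩, (mk_mem_pointsOn _ _).2 (mem_span_cubicVec_right s v)⟩

variable [CharP F 3]

theorem numLinesThrough_of_mem_TOPoints {p : ℙ F (Fin 4 → F)} (hp : p ∈ TOPoints F) :
    numLinesThrough (UnGClass F (-1)) p = 0 ∧
      numLinesThrough (UnGClass F 1) p = Fintype.card F := by
  induction p using Projectivization.ind with
  | h v hv =>
  obtain ⟨hc, hd, hax⟩ := (mk_mem_TOPoints hv).1 hp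
  obtain ⟨s₀, hs₀⟩ := exists_osc_eq_zero_iff hax
  obtain ⟨s, hs⟩ := exists_tangent_of_disc_eq_zero two_ne_zero_of_charP_three hc hd
  rw [tangent_eq_span] at hs
  obtain ⟨a, b, rfl⟩ := Submodule.mem_span_pair.1 hs
  obtain rfl := (hs₀ s).1 (osc_tangent a b s)
  have hb : b ≠ 0 := by
    rintro rfl
    exact hc s a (by simp)
  have hχ : ∀ t, t ≠ s → quadraticChar F (hess (a • cubicVec s + b • tangentVec s) t) = 1 := by
    intro t ht
    obtain ⟨y, hy, h⟩ := exists_hess_tangent_eq_sq (a := a) hb ht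
    rw [h, quadraticChar_sq_one' hy]
  rw [numLinesThrough_UnGClass (by simp) hv hc, numLinesThrough_UnGClass (by simp) hv hc]
  constructor
  · rw [Set.ncard_eq_zero]
    ext t
    simp only [ne_eq, hs₀, Set.mem_ofPred_eq, Set.mem_empty_iff_false, iff_false, not_and]
    intro ht
    rw [hχ t ht]
    norm_num
  · have : {t | osc (a • cubicVec s + b • tangentVec s) t ≠ 0 ∧
        quadraticChar F (hess (a • cubicVec s + b • tangentVec s) t) = 1} = {s}ᶜ := by
      ext t
      simp only [ne_eq, hs₀, Set.mem_ofPred_eq, Set.mem_compl_iff, Set.mem_singleton_iff,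
        and_iff_left_iff_imp]
      exact hχ t
    rw [this, Set.ncard_compl]
    simp

/-- For a point with nonzero discriminant, the Hessian form takes square and nonsquare values equally
often. The line joining the point to the foot of its own osculating plane lies in that plane and has
to be discarded; there the value is a square. -/
theorem two_mul_numLinesThrough {v : Fin 4 → F} (hv : v ≠ 0) (hd : disc v ≠ 0) :
    2 * (numLinesThrough (UnGClass F (-1)) (Projectivization.mk F v hv) : ℤ) =
        Fintype.card F - quadraticChar F (disc v) ∧
      2 * (numLinesThrough (UnGClass F 1) (Projectivization.mk F v hv) : ℤ) =
        Fintype.card F - 2 - quadraticChar F (disc v) := by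
  have hc : ∀ s, ∀ c : F, v ≠ c • cubicVec s := by
    have := mk_notMem_cubic_of_disc_ne_zero hv hd
    rw [mk_mem_cubic] at this
    push Not at this
    exact this
  have hax : ¬ (v 0 = 0 ∧ v 3 = 0) := by
    rintro ⟨h0, h3⟩
    refine hd ?_
    have h := three_eq_zero (F := F)
    simp only [disc, h0, h3]
    linear_combination -(v 1 ^ 2 * v 2 ^ 2) * h
  obtain ⟨s₀, hs₀⟩ := exists_osc_eq_zero_iff hax
  obtain ⟨y, hy, hy0⟩ := exists_hess_eq_sq_of_osc_eq_zero ((hs₀ s₀).2 rfl)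
  have hχ : quadraticChar F (hess v s₀) = 1 := by
    rw [hy, quadraticChar_sq_one' fun h => hd (hy0 h)]
  rw [numLinesThrough_UnGClass (by simp) hv hc, numLinesThrough_UnGClass (by simp) hv hc]
  simp only [ne_eq, hs₀]
  constructor
  · have h := two_mul_ncard_quadraticChar_formVal ringChar_ne_two hd (ε := -1) (by simp)
    have hset : {s | ¬ s = s₀ ∧ quadraticChar F (hess v s) = -1} =
        {s | quadraticChar F (hess v s) = -1} := by
      ext s
      simp only [Set.mem_ofPred_eq, and_iff_right_iff_imp]
      rintro h rfl
      rw [hχ] at h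
      norm_num at h
    rw [hset]
    exact h
  · have h := two_mul_ncard_quadraticChar_formVal ringChar_ne_two hd (ε := 1) (by simp)
    have hset : {s | ¬ s = s₀ ∧ quadraticChar F (hess v s) = 1} =
        {s | quadraticChar F (hess v s) = 1} \ {s₀} := by
      ext s
      simp [and_comm]
    have hcard : ({s | quadraticChar F (hess v s) = 1} \ {s₀}).ncard + 1 =
        {s | quadraticChar F (hess v s) = 1}.ncard := Set.ncard_sdiff_singleton_add_one hχ
    change 2 * ({s | quadraticChar F (hess v s) = 1}.ncard : ℤ) =
      Fintype.card F - quadraticChar F (disc v) at h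
    rw [hset]
    rw [← hcard] at h
    push_cast at h
    linarith

end LinesThrough

/-! ### Numbers of points on a line -/

section PointsOn

variable {F : Type*} [Field F]

/-- Apart from `P(s)`, the points of a line through `P(s)` are parametrized by the field. -/
theorem numPointsOn_span {s : Option F} {w : Fin 4 → F} (ho : osc w s ≠ 0)
    {M : Set (ℙ F (Fin 4 → F))} (hM : cubicPoint s ∉ M) {p : F → Prop}
    (hp : ∀ x, ∀ h : x • cubicVec s + w ≠ 0,
      Projectivization.mk F (x • cubicVec s + w) h ∈ M ↔ p x) :
    numPointsOn M (Submodule.span F {cubicVec s, w}) = {x | p x}.ncard := by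
  have hosc : ∀ x : F, osc (x • cubicVec s + w) s = osc w s := by
    intro x
    simpa using osc_comb x 1 w s
  have hne : ∀ x : F, x • cubicVec s + w ≠ 0 := by
    intro x h
    apply ho
    rw [← hosc x, h]
    cases s <;> simp [osc_none, osc_some]
  have hinj : Function.Injective fun x => Projectivization.mk F (x • cubicVec s + w) (hne x) := by
    intro x y h
    obtain ⟨c, hc⟩ := (Projectivization.mk_eq_mk_iff' F _ _ (hne x) (hne y)).1 h
    have h1 : c = 1 := by
      have := congrArg (fun v => osc v s) hc
      simp only [smul_add, smul_smul] at this
      rw [osc_comb, hosc] at this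
      exact mul_right_cancel₀ ho (by rw [this, one_mul])
    rw [h1, one_smul, add_left_inj] at hc
    exact (smul_left_injective F (cubicVec_ne_zero s) hc).symm
  rw [← Set.ncard_image_of_injective _ hinj, numPointsOn]
  congr 1
  ext P
  constructor
  · rintro ⟨hP, hl⟩
    induction P using Projectivization.ind with
    | h v hv =>
    rw [mk_mem_pointsOn] at hl
    obtain ⟨a, b, rfl⟩ := Submodule.mem_span_pair.1 hl
    have hb : b ≠ 0 := by
      rintro rfl
      refine hM ?_
      convert hP using 1
      exact (Projectivization.mk_eq_mk_iff' F _ _ _ _).2 ⟨a⁻¹, by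
        have ha : a ≠ 0 := by
          rintro rfl
          simp at hv
        rw [zero_smul, add_zero, smul_smul, inv_mul_cancel₀ ha, one_smul]⟩
    have heq : Projectivization.mk F ((b⁻¹ * a) • cubicVec s + w) (hne _) =
        Projectivization.mk F (a • cubicVec s + b • w) hv := by
      refine (Projectivization.mk_eq_mk_iff' F _ _ _ _).2 ⟨b⁻¹, ?_⟩
      rw [smul_add, smul_smul, smul_smul, inv_mul_cancel₀ hb, one_smul]
    exact ⟨b⁻¹ * a, (hp _ _).1 (heq ▸ hP), heq⟩
  · rintro ⟨x, hx, rfl⟩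
    refine ⟨(hp x (hne x)).2 hx, (mk_mem_pointsOn _ _).2 ?_⟩
    exact Submodule.mem_span_pair.2 ⟨x, 1, by rw [one_smul]⟩

theorem exists_normalized [Fintype F] [DecidableEq F] {ε : ℤ} {l : Submodule F (Fin 4 → F)} (hl : l ∈ UnGClass F ε) :
    ∃ s w, l = Submodule.span F {cubicVec s, w} ∧ osc w s = 1 ∧
      quadraticChar F (hess w s) = ε := by
  obtain ⟨s, w, rfl, ho, hh⟩ := hl
  have hb : (osc w s)⁻¹ ≠ 0 := inv_ne_zero ho
  have h1 : osc ((osc w s)⁻¹ • w) s = 1 := by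
    have := osc_comb 0 (osc w s)⁻¹ w s
    rwa [zero_smul, zero_add, inv_mul_cancel₀ ho] at this
  have h2 : hess ((osc w s)⁻¹ • w) s = (osc w s)⁻¹ ^ 2 * hess w s := by
    simpa using hess_comb 0 (osc w s)⁻¹ w s
  refine ⟨s, (osc w s)⁻¹ • w, ?_, h1, ?_⟩
  · refine span_pair_eq_of_isLine (isLine_span_cubicVec ho) (cubicVec_ne_zero s) (fun c hc => ?_)
      (cubicVec_mem_span s w) (Submodule.smul_mem _ _ (mem_span_cubicVec_right s w))
    have := osc_comb c 0 w s
    rw [zero_smul, add_zero, hc, h1, zero_mul] at this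
    exact one_ne_zero this
  · rw [h2, map_mul, quadraticChar_sq_one' hb, one_mul, hh]

variable [CharP F 3]

theorem exists_disc_eq_sq_sub {s : Option F} {w : Fin 4 → F} (ho : osc w s = 1) :
    ∃ e, ∀ x : F, disc (x • cubicVec s + w) = (x + e) ^ 2 - hess w s ^ 3 := by
  have h3 : (3 : F) = 0 := three_eq_zero
  have hosc : ∀ x : F, osc (x • cubicVec s + w) s = 1 := by
    intro x
    rw [← ho]
    simpa using osc_comb x 1 w s
  have hhess : ∀ x : F, hess (x • cubicVec s + w) s = hess w s := by
    intro x
    simpa using hess_comb x 1 w s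
  cases s with
  | none =>
    refine ⟨w 0 - w 2 ^ 3, fun x => ?_⟩
    have h := osc_sq_mul_disc_none (x • cubicVec none + w)
    have hx0 : (x • cubicVec none + w : Fin 4 → F) 0 = x + w 0 := by
      rw [Pi.add_apply, Pi.smul_apply]
      simp [cubicVec_none]
    have hx2 : (x • cubicVec none + w : Fin 4 → F) 2 = w 2 := by
      rw [Pi.add_apply, Pi.smul_apply]
      simp [cubicVec_none]
    rw [hosc, hhess, hx0, hx2, one_pow, one_mul, mul_one] at h
    rw [h]
    ring
  | some s =>
    refine ⟨w 3 - (w 1 + s * w 2 + s ^ 2 * w 3) ^ 3, fun x => ?_⟩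
    have h := osc_sq_mul_disc (x • cubicVec (some s) + w) s
    have hy : (x • cubicVec (some s) + w) 1 + s * (x • cubicVec (some s) + w) 2 +
        s ^ 2 * (x • cubicVec (some s) + w) 3 = w 1 + s * w 2 + s ^ 2 * w 3 := by
      simp only [Pi.add_apply, Pi.smul_apply, cubicVec_some, smul_eq_mul]
      simp
      linear_combination x * s ^ 2 * h3
    have hx3 : (x • cubicVec (some s) + w) 3 = x + w 3 := by
      rw [Pi.add_apply, Pi.smul_apply]
      simp [cubicVec_some]
    rw [hosc, hhess, hy, hx3, one_pow, one_mul, mul_one] at h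
    rw [h]
    ring

variable [Fintype F] [DecidableEq F]

theorem numPointsOn_UnGClass {ε : ℤ} (hε : ε = 1 ∨ ε = -1) {l : Submodule F (Fin 4 → F)}
    (hl : l ∈ UnGClass F ε) :
    (numPointsOn (TOPoints F) l : ℤ) = 1 + ε ∧
      2 * (numPointsOn (ICPoints F) l : ℤ) = Fintype.card F - ε ∧
      2 * (numPointsOn (RCPoints F) l : ℤ) = Fintype.card F - 2 - ε := by
  obtain ⟨s, w, rfl, ho, hh⟩ := exists_normalized hl
  have ho' : osc w s ≠ 0 := by rw [ho]; exact one_ne_zero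
  have h0 : hess w s ≠ 0 := ne_zero_of_quadraticChar hε hh
  obtain ⟨e, he⟩ := exists_disc_eq_sq_sub ho
  have hχ : quadraticChar F (hess w s ^ 3) = ε := by
    rw [map_pow, hh]
    rcases hε with rfl | rfl <;> norm_num
  have hshift : Function.Bijective fun x : F => x + e := (Equiv.addRight e).bijective
  have hcount : ∀ δ : ℤ, δ = 1 ∨ δ = -1 →
      2 * ({x : F | quadraticChar F (disc (x • cubicVec s + w)) = δ}.ncard : ℤ) =
        Fintype.card F - 1 - ε - δ := by
    intro δ hδ
    simp only [he]
    rw [ncard_preimage_of_bijective hshift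
      (fun u => quadraticChar F (u ^ 2 - hess w s ^ 3) = δ),
      two_mul_ncard_quadraticChar_sq_sub ringChar_ne_two (by positivity) hδ, hχ]
  refine ⟨?_, ?_, ?_⟩
  · rw [numPointsOn_span ho' (p := fun x : F => disc (x • cubicVec s + w) = 0)]
    · simp only [he, sub_eq_zero]
      rw [ncard_preimage_of_bijective hshift (fun u => u ^ 2 = hess w s ^ 3),
        ncard_sq_eq ringChar_ne_two, hχ, add_comm]
    · rintro ⟨h, -⟩
      exact h ⟨s, rfl⟩
    · intro x h
      rw [mk_mem_TOPoints]
      refine ⟨fun h => h.2.1, fun hd => ⟨fun t c hc => h0 ?_, hd, fun hax => ho' ?_⟩⟩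
      · have h₁ := hess_comb x 1 w s
        have h₂ := hess_comb 0 c (cubicVec t) s
        rw [one_smul, hc, one_pow, one_mul] at h₁
        rw [zero_smul, zero_add, hess_cubicVec, mul_zero] at h₂
        rw [← h₁, h₂]
      · have h₁ := osc_comb x 1 w s
        rw [one_smul, one_mul] at h₁
        rw [← h₁]
        cases s <;> simp only [osc_none, osc_some, hax.1, hax.2] <;> ring
  · rw [numPointsOn_span ho' (p := fun x : F => quadraticChar F (disc (x • cubicVec s + w)) = -1),
      hcount (-1) (by simp)]
    · ring
    · rw [cubicPoint, mk_mem_ICPoints ringChar_ne_two, disc_cubicVec, quadraticChar_zero]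
      norm_num
    · exact fun x h => mk_mem_ICPoints ringChar_ne_two h
  · rw [numPointsOn_span ho' (p := fun x : F => quadraticChar F (disc (x • cubicVec s + w)) = 1),
      hcount 1 (by simp)]
    · ring
    · rintro ⟨h, -⟩
      exact h ⟨s, rfl⟩
    · exact fun x h => mk_mem_RCPoints two_ne_zero_of_charP_three h

end PointsOn

/-! ### The group of the cubic -/

section Group

variable {F : Type*} [Field F]

theorem map_mul_eq (g h : (Fin 4 → F) ≃ₗ[F] (Fin 4 → F)) (l : Submodule F (Fin 4 → F)) :
    Submodule.map ((g * h : (Fin 4 → F) ≃ₗ[F] (Fin 4 → F)) : (Fin 4 → F) →ₗ[F] (Fin 4 → F)) l =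
      Submodule.map (g : (Fin 4 → F) →ₗ[F] (Fin 4 → F))
        (Submodule.map (h : (Fin 4 → F) →ₗ[F] (Fin 4 → F)) l) := by
  rw [← Submodule.map_comp]
  rfl

theorem map_inv_map (g : (Fin 4 → F) ≃ₗ[F] (Fin 4 → F)) (l : Submodule F (Fin 4 → F)) :
    Submodule.map ((g⁻¹ : (Fin 4 → F) ≃ₗ[F] (Fin 4 → F)) : (Fin 4 → F) →ₗ[F] (Fin 4 → F))
      (Submodule.map (g : (Fin 4 → F) →ₗ[F] (Fin 4 → F)) l) = l := by
  rw [← map_mul_eq, inv_mul_cancel]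
  exact Submodule.map_id l

theorem map_span_pair (g : (Fin 4 → F) ≃ₗ[F] (Fin 4 → F)) (v w : Fin 4 → F) :
    Submodule.map (g : (Fin 4 → F) →ₗ[F] (Fin 4 → F)) (Submodule.span F {v, w}) =
      Submodule.span F {g v, g w} := by
  rw [Submodule.map_span, Set.image_pair]
  rfl

/-- As the cubic is finite, mapping it into itself is enough to belong to the group. -/
theorem mem_cubicGroup_iff [Finite F] {g : (Fin 4 → F) ≃ₗ[F] (Fin 4 → F)} :
    g ∈ cubicGroup F ↔ ∀ s, ∃ t, ∃ c : F, g (cubicVec s) = c • cubicVec t := by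
  have hfin : (cubic F).Finite := Set.finite_range _
  have hmk : ∀ s, g • cubicPoint s = Projectivization.mk F (g (cubicVec s))
      (by simpa using cubicVec_ne_zero s) := fun s => rfl
  rw [cubicGroup, MulAction.mem_stabilizer_set_iff_smul_set_subset hfin]
  constructor
  · intro h s
    have := h (Set.smul_mem_smul_set ⟨s, rfl⟩ : g • cubicPoint s ∈ g • cubic F)
    rwa [hmk, mk_mem_cubic] at this
  · rintro h _ ⟨_, ⟨s, rfl⟩, rfl⟩
    simp only
    rw [hmk, mk_mem_cubic]
    exact h s

/-- The action of `t ↦ k t + c` on the coordinates. -/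
def affineEquiv (k c : F) (hk : k ≠ 0) : (Fin 4 → F) ≃ₗ[F] (Fin 4 → F) where
  toFun x := ![k ^ 3 * x 0 + 3 * k ^ 2 * c * x 1 + 3 * k * c ^ 2 * x 2 + c ^ 3 * x 3,
    k ^ 2 * x 1 + 2 * k * c * x 2 + c ^ 2 * x 3, k * x 2 + c * x 3, x 3]
  invFun x := ![(x 0 - 3 * c * x 1 + 3 * c ^ 2 * x 2 - c ^ 3 * x 3) / k ^ 3,
    (x 1 - 2 * c * x 2 + c ^ 2 * x 3) / k ^ 2, (x 2 - c * x 3) / k, x 3]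
  map_add' x y := by
    ext i
    fin_cases i <;> simp <;> ring
  map_smul' a x := by
    ext i
    fin_cases i <;> simp <;> ring
  left_inv x := by
    ext i
    fin_cases i <;> simp <;> field_simp <;> ring
  right_inv x := by
    ext i
    fin_cases i <;> simp <;> field_simp <;> ring

/-- The action of `t ↦ 1 / t` on the coordinates. -/
def reversal (F : Type*) [Field F] : (Fin 4 → F) ≃ₗ[F] (Fin 4 → F) where
  toFun x := ![x 3, x 2, x 1, x 0]
  invFun x := ![x 3, x 2, x 1, x 0]
  map_add' x y := by
    ext i
    fin_cases i <;> simp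
  map_smul' a x := by
    ext i
    fin_cases i <;> simp
  left_inv x := by
    ext i
    fin_cases i <;> simp
  right_inv x := by
    ext i
    fin_cases i <;> simp

theorem affineEquiv_apply (k c : F) (hk : k ≠ 0) (x : Fin 4 → F) : affineEquiv k c hk x =
    ![k ^ 3 * x 0 + 3 * k ^ 2 * c * x 1 + 3 * k * c ^ 2 * x 2 + c ^ 3 * x 3,
      k ^ 2 * x 1 + 2 * k * c * x 2 + c ^ 2 * x 3, k * x 2 + c * x 3, x 3] := rfl

theorem reversal_apply (x : Fin 4 → F) : reversal F x = ![x 3, x 2, x 1, x 0] := rfl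

theorem affineEquiv_mem [Finite F] (k c : F) (hk : k ≠ 0) : affineEquiv k c hk ∈ cubicGroup F := by
  rw [mem_cubicGroup_iff]
  intro s
  cases s with
  | none =>
    refine ⟨none, k ^ 3, ?_⟩
    rw [affineEquiv_apply]
    ext i
    fin_cases i <;> simp [cubicVec_none]
  | some t =>
    refine ⟨some (k * t + c), 1, ?_⟩
    rw [affineEquiv_apply]
    ext i
    fin_cases i <;> simp [cubicVec_some] <;> ring

theorem reversal_mem [Finite F] : reversal F ∈ cubicGroup F := by
  rw [mem_cubicGroup_iff]
  intro s
  cases s with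
  | none =>
    refine ⟨some 0, 1, ?_⟩
    rw [reversal_apply]
    ext i
    fin_cases i <;> simp [cubicVec_none, cubicVec_some]
  | some t =>
    by_cases ht : t = 0
    · refine ⟨none, 1, ?_⟩
      rw [reversal_apply]
      ext i
      fin_cases i <;> simp [cubicVec_none, cubicVec_some, ht]
    · refine ⟨some t⁻¹, t ^ 3, ?_⟩
      rw [reversal_apply]
      ext i
      fin_cases i <;> simp [cubicVec_some] <;> field_simp

/-- A projectivity of the cubic moving `P(s)` to `P(∞)`: the action of `t ↦ 1 / (t - s)`. -/
def toInfty : Option F → ((Fin 4 → F) ≃ₗ[F] (Fin 4 → F))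
  | none => 1
  | some s => reversal F * affineEquiv 1 (-s) one_ne_zero

theorem toInfty_mem [Finite F] (s : Option F) : toInfty s ∈ cubicGroup F := by
  cases s with
  | none => exact one_mem _
  | some s => exact mul_mem reversal_mem (affineEquiv_mem _ _ _)

theorem toInfty_some_apply (s : F) (x : Fin 4 → F) : toInfty (some s) x =
    reversal F (affineEquiv 1 (-s) one_ne_zero x) := rfl

theorem toInfty_cubicVec (s : Option F) : toInfty s (cubicVec s) = cubicVec none := by
  cases s with
  | none => rfl
  | some s =>
    rw [toInfty_some_apply, reversal_apply, affineEquiv_apply]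
    ext i
    fin_cases i <;> simp [cubicVec_none, cubicVec_some] <;> ring

theorem osc_toInfty [CharP F 3] (s : Option F) (v : Fin 4 → F) :
    osc (toInfty s v) none = osc v s := by
  have h3 : (3 : F) = 0 := three_eq_zero
  cases s with
  | none => rfl
  | some s =>
    rw [toInfty_some_apply, reversal_apply, affineEquiv_apply, osc_none, osc_some]
    simp [h3]
    ring

theorem hess_toInfty [CharP F 3] (s : Option F) (v : Fin 4 → F) :
    hess (toInfty s v) none = hess v s := by
  have h3 : (3 : F) = 0 := three_eq_zero
  cases s with
  | none => rfl
  | some s =>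
    rw [toInfty_some_apply, reversal_apply, affineEquiv_apply, hess_none, hess_some]
    simp [h3]
    generalize v 0 = x0, v 1 = x1, v 2 = x2, v 3 = x3
    grind

theorem hess_affineEquiv (k c : F) (hk : k ≠ 0) (v : Fin 4 → F) :
    hess (affineEquiv k c hk v) none = k ^ 2 * hess v none := by
  rw [affineEquiv_apply, hess_none, hess_none]
  simp
  ring

theorem coeffs_eq_zero_of_forall [Fintype F] (hq : 5 ≤ Fintype.card F) {e₀ e₁ e₂ e₃ e₄ : F}
    (h : ∀ t : F, e₄ * t ^ 4 + e₃ * t ^ 3 + e₂ * t ^ 2 + e₁ * t + e₀ = 0) :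
    e₄ = 0 ∧ e₃ = 0 ∧ e₂ = 0 ∧ e₁ = 0 ∧ e₀ = 0 := by
  open Polynomial in
  have hp : (C e₄ * X ^ 4 + C e₃ * X ^ 3 + C e₂ * X ^ 2 + C e₁ * X + C e₀ : F[X]) = 0 := by
    refine eq_zero_of_natDegree_lt_card_of_eval_eq_zero _ (f := id) Function.injective_id
      (fun t => ?_) (lt_of_le_of_lt (b := 4) (by compute_degree) hq)
    simpa using h t
  have hc := fun n => congrArg (fun p => Polynomial.coeff p n) hp
  have h0 := hc 0
  have h1 := hc 1
  have h2 := hc 2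
  have h3 := hc 3
  have h4 := hc 4
  simp [Polynomial.coeff_X, Polynomial.coeff_C, Polynomial.coeff_X_pow] at h0 h1 h2 h3 h4
  exact ⟨h4, h3, h2, h1, h0⟩

/-- Three quadratic polynomials mapping the conic `(t², t, 1)` to itself and fixing its point at
infinity: if the third has no zero and the second is not a multiple of it, then the third is constant
and the second is linear. -/
theorem conic_stabilizer {a₁ b₁ c₁ a₂ b₂ c₂ a₃ b₃ c₃ : F}
    (E4 : a₁ * a₃ = a₂ ^ 2) (E3 : a₁ * b₃ + b₁ * a₃ = 2 * a₂ * b₂)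
    (E2 : a₁ * c₃ + b₁ * b₃ + c₁ * a₃ = 2 * a₂ * c₂ + b₂ ^ 2)
    (E1 : b₁ * c₃ + c₁ * b₃ = 2 * b₂ * c₂) (E0 : c₁ * c₃ = c₂ ^ 2)
    (hroot : ∀ t, a₃ * t ^ 2 + b₃ * t + c₃ ≠ 0)
    (hind : ∀ r, ¬ (a₂ = r * a₃ ∧ b₂ = r * b₃ ∧ c₂ = r * c₃)) :
    a₃ = 0 ∧ b₃ = 0 ∧ a₂ = 0 ∧ c₃ ≠ 0 ∧ b₂ ≠ 0 := by
  have ha₃ : a₃ = 0 := by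
    by_contra ha
    -- subtracting a multiple of the third polynomial makes the second linear
    obtain ⟨r, hr⟩ : ∃ r, a₂ = r * a₃ := ⟨a₂ / a₃, by field_simp⟩
    have h1 : a₁ = r ^ 2 * a₃ := by
      apply mul_right_cancel₀ ha
      rw [E4, hr]
      ring
    have h2 : b₁ = 2 * r * b₂ - r ^ 2 * b₃ := by
      apply mul_right_cancel₀ ha
      rw [h1, hr] at E3
      linear_combination E3
    obtain ⟨β, hβ⟩ : ∃ β, β = b₂ - r * b₃ := ⟨_, rfl⟩
    obtain ⟨γ, hγ⟩ : ∃ γ, γ = c₂ - r * c₃ := ⟨_, rfl⟩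
    obtain ⟨δ, hδ⟩ : ∃ δ, δ = c₁ - 2 * r * c₂ + r ^ 2 * c₃ := ⟨_, rfl⟩
    have k2 : δ * a₃ = β ^ 2 := by
      rw [hδ, hβ]
      rw [h1, h2, hr] at E2
      linear_combination E2
    have k1 : δ * b₃ = 2 * β * γ := by
      rw [hδ, hβ, hγ]
      rw [h2] at E1
      linear_combination E1
    have k0 : δ * c₃ = γ ^ 2 := by
      rw [hδ, hγ]
      linear_combination E0
    by_cases hβ0 : β = 0
    · have hδ0 : δ = 0 := by
        rw [hβ0] at k2
        simpa [ha] using k2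
      have hγ0 : γ = 0 := by
        rw [hδ0] at k0
        simpa using k0.symm
      exact hind r ⟨hr, by linear_combination hβ0 - hβ, by linear_combination hγ0 - hγ⟩
    · have hδ0 : δ ≠ 0 := by
        rintro h
        rw [h, zero_mul] at k2
        exact hβ0 (by simpa using k2.symm)
      have hz : β * (-γ / β) + γ = 0 := by
        field_simp
        ring
      refine hroot (-γ / β) (mul_left_cancel₀ hδ0 ?_)
      linear_combination (-γ / β) ^ 2 * k2 + (-γ / β) * k1 + k0 + (β * (-γ / β) + γ) * hz
  have hb₃ : b₃ = 0 := by
    by_contra hb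
    refine hroot (-c₃ / b₃) ?_
    rw [ha₃]
    field_simp
    ring
  have ha₂ : a₂ = 0 := by
    rw [ha₃, mul_zero] at E4
    simpa using E4.symm
  have hc₃ : c₃ ≠ 0 := by
    have := hroot 0
    simpa using this
  refine ⟨ha₃, hb₃, ha₂, hc₃, fun hb₂ => hind (c₂ / c₃) ⟨by simp [ha₂, ha₃], by simp [hb₂, hb₃], ?_⟩⟩
  field_simp

/-- A linear map of the group fixing `P(∞)` preserves its osculating plane, and multiplies the
Hessian form at `∞` by a square. -/
theorem exists_factors_of_fix_infty [Fintype F] (hq : 5 ≤ Fintype.card F)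
    {g : (Fin 4 → F) ≃ₗ[F] (Fin 4 → F)} (hg : g ∈ cubicGroup F) {c : F}
    (hc : g (cubicVec none) = c • cubicVec none) :
    ∃ β γ : F, β ≠ 0 ∧ γ ≠ 0 ∧ ∀ v, osc (g v) none = γ * osc v none ∧
      hess (g v) none = β ^ 2 * hess v none := by
  rw [mem_cubicGroup_iff] at hg
  obtain ⟨m, hm⟩ : ∃ m : Fin 4 → Fin 4 → F, ∀ v i,
      g v i = v 0 * m i 0 + v 1 * m i 1 + v 2 * m i 2 + v 3 * m i 3 := by
    refine ⟨fun i j => g (fun k => if j = k then 1 else 0) i, fun v i => ?_⟩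
    have := LinearMap.pi_apply_eq_sum_univ (g : (Fin 4 → F) →ₗ[F] (Fin 4 → F)) v
    rw [Fin.sum_univ_four] at this
    simpa using congrFun this i
  have hm0 : ∀ i, m i 0 = c * cubicVec none i := by
    intro i
    have h := hm (cubicVec none) i
    rw [hc] at h
    simpa [cubicVec_none] using h.symm
  have hm1 : m 1 0 = 0 := by rw [hm0]; simp [cubicVec_none]
  have hm2 : m 2 0 = 0 := by rw [hm0]; simp [cubicVec_none]
  have hm3 : m 3 0 = 0 := by rw [hm0]; simp [cubicVec_none]
  have hc0 : c ≠ 0 := by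
    rintro rfl
    rw [zero_smul] at hc
    exact cubicVec_ne_zero none (g.map_eq_zero_iff.1 hc)
  have hval : ∀ t : F, ∀ i ≠ 0, g (cubicVec (some t)) i = m i 1 * t ^ 2 + m i 2 * t + m i 3 := by
    intro t i hi
    rw [hm, hm0]
    have : cubicVec (none : Option F) i = 0 := by
      fin_cases i
      · exact absurd rfl hi
      · simp [cubicVec_none]
      · simp [cubicVec_none]
      · simp [cubicVec_none]
    rw [this]
    simp [cubicVec_some]
    ring
  have himage : ∀ t : F, ∃ u d : F, d ≠ 0 ∧ g (cubicVec (some t)) = d • cubicVec (some u) := by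
    intro t
    obtain ⟨s, d, h⟩ := hg (some t)
    have hd : d ≠ 0 := by
      rintro rfl
      rw [zero_smul] at h
      exact cubicVec_ne_zero _ (g.map_eq_zero_iff.1 h)
    cases s with
    | none =>
      exfalso
      have : g (cubicVec (some t)) = g ((d * c⁻¹) • cubicVec none) := by
        rw [map_smul, hc, h, smul_smul, inv_mul_cancel_right₀ hc0]
      exact absurd (eq_of_smul_cubicVec_eq (g.injective this).symm) (by simp)
    | some u => exact ⟨u, d, hd, h⟩
  have hconic : ∀ t : F, (m 1 1 * t ^ 2 + m 1 2 * t + m 1 3) * (m 3 1 * t ^ 2 + m 3 2 * t + m 3 3) =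
      (m 2 1 * t ^ 2 + m 2 2 * t + m 2 3) ^ 2 := by
    intro t
    obtain ⟨u, d, -, h⟩ := himage t
    rw [← hval t 1 (by decide), ← hval t 2 (by decide), ← hval t 3 (by decide), h]
    simp [cubicVec_some]
    ring
  have hroot : ∀ t : F, m 3 1 * t ^ 2 + m 3 2 * t + m 3 3 ≠ 0 := by
    intro t
    obtain ⟨u, d, hd, h⟩ := himage t
    rw [← hval t 3 (by decide), h]
    simpa [cubicVec_some] using hd
  obtain ⟨E4, E3, E2, E1, E0⟩ := coeffs_eq_zero_of_forall hq
    (e₄ := m 1 1 * m 3 1 - m 2 1 ^ 2)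
    (e₃ := m 1 1 * m 3 2 + m 1 2 * m 3 1 - 2 * m 2 1 * m 2 2)
    (e₂ := m 1 1 * m 3 3 + m 1 2 * m 3 2 + m 1 3 * m 3 1 - (2 * m 2 1 * m 2 3 + m 2 2 ^ 2))
    (e₁ := m 1 2 * m 3 3 + m 1 3 * m 3 2 - 2 * m 2 2 * m 2 3)
    (e₀ := m 1 3 * m 3 3 - m 2 3 ^ 2) (fun t => by linear_combination hconic t)
  obtain ⟨ha₃, hb₃, ha₂, hc₃, hb₂⟩ := conic_stabilizer (sub_eq_zero.1 E4) (sub_eq_zero.1 E3)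
    (sub_eq_zero.1 E2) (sub_eq_zero.1 E1) (sub_eq_zero.1 E0) hroot (by
      rintro r ⟨h1, h2, h3⟩
      obtain ⟨v, hv⟩ := g.surjective ![0, 0, 1, 0]
      have e2 := hm v 2
      have e3 := hm v 3
      rw [hv, hm2, h1, h2, h3] at e2
      rw [hv, hm3] at e3
      simp at e2 e3
      exact one_ne_zero (α := F) (by linear_combination e2 - r * e3))
  refine ⟨m 2 2, m 3 3, hb₂, hc₃, fun v => ⟨?_, ?_⟩⟩
  · rw [osc_none, osc_none, hm, hm3, ha₃, hb₃]
    ring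
  · rw [ha₃, hb₃, ha₂] at E2
    rw [hb₃] at E1
    rw [hess_none, hess_none, hm v 1, hm v 2, hm v 3, hm1, hm2, hm3, ha₃, hb₃, ha₂]
    linear_combination -(v 1 * v 3) * E2 - (v 2 * v 3) * E1 - (v 3 ^ 2) * E0

theorem map_toInfty (s : Option F) (w : Fin 4 → F) :
    Submodule.map (toInfty s : (Fin 4 → F) →ₗ[F] (Fin 4 → F)) (Submodule.span F {cubicVec s, w}) =
      Submodule.span F {cubicVec none, toInfty s w} := by
  rw [map_span_pair, toInfty_cubicVec]

variable [CharP F 3] [Fintype F] [DecidableEq F]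

theorem map_mem_UnGClass (hq : 5 ≤ Fintype.card F) {ε : ℤ} {l : Submodule F (Fin 4 → F)}
    (hl : l ∈ UnGClass F ε) {g : (Fin 4 → F) ≃ₗ[F] (Fin 4 → F)} (hg : g ∈ cubicGroup F) :
    Submodule.map (g : (Fin 4 → F) →ₗ[F] (Fin 4 → F)) l ∈ UnGClass F ε := by
  obtain ⟨s, w, rfl, ho, hh⟩ := hl
  obtain ⟨t, c, hc⟩ := mem_cubicGroup_iff.1 hg s
  have hc0 : c ≠ 0 := by
    rintro rfl
    rw [zero_smul] at hc
    exact cubicVec_ne_zero s (g.map_eq_zero_iff.1 hc)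
  have hinv : (toInfty s)⁻¹ (cubicVec none) = cubicVec s := by
    rw [← toInfty_cubicVec s]
    exact (toInfty s).symm_apply_apply _
  have hfix : (toInfty t * g * (toInfty s)⁻¹) (cubicVec none) = c • cubicVec none := by
    rw [LinearEquiv.mul_apply, LinearEquiv.mul_apply, hinv, hc, map_smul, toInfty_cubicVec]
  obtain ⟨β, γ, hβ, hγ, h⟩ := exists_factors_of_fix_infty hq
    (mul_mem (mul_mem (toInfty_mem t) hg) (inv_mem (toInfty_mem s))) hfix
  have happ : (toInfty t * g * (toInfty s)⁻¹) (toInfty s w) = toInfty t (g w) := by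
    rw [LinearEquiv.mul_apply, LinearEquiv.mul_apply]
    congr 2
    exact (toInfty s).symm_apply_apply _
  obtain ⟨h1, h2⟩ := h (toInfty s w)
  rw [happ, osc_toInfty, osc_toInfty] at h1
  rw [happ, hess_toInfty, hess_toInfty] at h2
  have ho' : osc (g w) t ≠ 0 := by
    rw [h1]
    exact mul_ne_zero hγ ho
  refine ⟨t, g w, ?_, ho', ?_⟩
  · rw [map_span_pair, hc]
    apply le_antisymm
    · rw [Submodule.span_le]
      rintro x (rfl | rfl)
      · exact Submodule.smul_mem _ _ (cubicVec_mem_span t _)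
      · exact mem_span_cubicVec_right t _
    · rw [Submodule.span_le]
      rintro x (rfl | rfl)
      · exact Submodule.mem_span_pair.2 ⟨c⁻¹, 0, by simp [smul_smul, hc0]⟩
      · exact Submodule.subset_span (by simp)
  · rw [h2, map_mul, quadraticChar_sq_one' hβ, one_mul, hh]

/-- The group is transitive on each class: after moving the meeting points to `P(∞)`, the lines become
points of a plane off a conic, and `t ↦ k t + c` multiplies the invariant `hess` by `k²`. -/
theorem exists_map_eq {ε : ℤ} (hε : ε = 1 ∨ ε = -1) {l l' : Submodule F (Fin 4 → F)}
    (hl : l ∈ UnGClass F ε) (hl' : l' ∈ UnGClass F ε) :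
    ∃ g ∈ cubicGroup F, l' = Submodule.map (g : (Fin 4 → F) →ₗ[F] (Fin 4 → F)) l := by
  obtain ⟨s, w, rfl, ho, hh⟩ := exists_normalized hl
  obtain ⟨s', w', rfl, ho', hh'⟩ := exists_normalized hl'
  have h0 : hess w s ≠ 0 := ne_zero_of_quadraticChar hε hh
  have h0' : hess w' s' ≠ 0 := ne_zero_of_quadraticChar hε hh'
  obtain ⟨k, hk0, hk⟩ : ∃ k ≠ 0, hess w' s' = k ^ 2 * hess w s := by
    have hne : hess w' s' * hess w s ≠ 0 := mul_ne_zero h0' h0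
    have : quadraticChar F (hess w' s' * hess w s) = 1 := by
      rw [map_mul, hh, hh']
      rcases hε with rfl | rfl <;> norm_num
    obtain ⟨y, hy⟩ := (quadraticChar_one_iff_isSquare hne).1 this
    refine ⟨y / hess w s, div_ne_zero ?_ h0, ?_⟩
    · rintro rfl
      exact hne (by simpa using hy)
    · field_simp
      linear_combination hy
  obtain ⟨x, hx⟩ : ∃ x, x = toInfty s w := ⟨_, rfl⟩
  obtain ⟨x', hx'⟩ : ∃ x', x' = toInfty s' w' := ⟨_, rfl⟩
  have hx3 : x 3 = 1 := by rw [hx, ← ho, ← osc_toInfty, osc_none]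
  have hx3' : x' 3 = 1 := by rw [hx', ← ho', ← osc_toInfty, osc_none]
  set A := affineEquiv k (x' 2 - k * x 2) hk0 with hA
  have hAx2 : A x 2 = x' 2 := by
    rw [hA, affineEquiv_apply]
    simp [hx3]
  have hAx3 : A x 3 = x' 3 := by
    rw [hA, affineEquiv_apply]
    simp [hx3, hx3']
  have hAx1 : A x 1 = x' 1 := by
    have h1 : hess (A x) none = hess x' none := by
      rw [hA, hess_affineEquiv, hx, hx', hess_toInfty, hess_toInfty, hk]
    rw [hess_none, hess_none, hAx2, hAx3, hx3'] at h1
    linear_combination -h1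
  have hspan : Submodule.map (A : (Fin 4 → F) →ₗ[F] (Fin 4 → F))
      (Submodule.span F {cubicVec none, x}) = Submodule.span F {cubicVec none, x'} := by
    have hAe : A (cubicVec none) = k ^ 3 • cubicVec none := by
      rw [hA, affineEquiv_apply]
      ext i
      fin_cases i <;> simp [cubicVec_none]
    have hAx : A x = (A x 0 - x' 0) • cubicVec none + x' := by
      ext i
      fin_cases i
      · simp [cubicVec_none]
      · simpa [cubicVec_none] using hAx1
      · simpa [cubicVec_none] using hAx2
      · simpa [cubicVec_none] using hAx3
    rw [map_span_pair, hAe]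
    apply le_antisymm
    · rw [Submodule.span_le]
      rintro y (rfl | rfl)
      · exact Submodule.smul_mem _ _ (cubicVec_mem_span _ _)
      · rw [hAx]
        exact Submodule.mem_span_pair.2 ⟨A x 0 - x' 0, 1, by rw [one_smul]⟩
    · rw [Submodule.span_le]
      rintro y (rfl | hy)
      · exact Submodule.mem_span_pair.2 ⟨(k ^ 3)⁻¹, 0, by simp [smul_smul, hk0]⟩
      · rw [Set.mem_singleton_iff.1 hy]
        refine Submodule.mem_span_pair.2 ⟨-((A x 0 - x' 0) * (k ^ 3)⁻¹), 1, ?_⟩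
        nth_rewrite 2 [hAx]
        rw [smul_smul, neg_mul, mul_assoc, inv_mul_cancel₀ (by positivity), mul_one, one_smul,
          neg_smul, neg_add_cancel_left]
  refine ⟨(toInfty s')⁻¹ * (A * toInfty s), mul_mem (inv_mem (toInfty_mem s'))
    (mul_mem (affineEquiv_mem _ _ _) (toInfty_mem s)), ?_⟩
  rw [map_mul_eq, map_mul_eq, map_toInfty, ← hx, hspan, hx', ← map_toInfty, map_inv_map]

theorem UnGClass_nonempty {ε : ℤ} (hε : ε = 1 ∨ ε = -1) : (UnGClass F ε).Nonempty := by
  obtain ⟨a, ha⟩ : ∃ a : F, quadraticChar F a = ε := by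
    rcases hε with rfl | rfl
    · exact ⟨1, by simp⟩
    · exact quadraticChar_exists_neg_one ringChar_ne_two
  refine ⟨_, none, ![0, -a, 0, 1], rfl, ?_, ?_⟩
  · simp [osc_none]
  · rw [← ha, hess_none]
    simp

theorem isLineOrbit_UnGClass (hq : 5 ≤ Fintype.card F) {ε : ℤ} (hε : ε = 1 ∨ ε = -1) :
    IsLineOrbit (UnGClass F ε) := by
  obtain ⟨l, hl⟩ := UnGClass_nonempty (F := F) hε
  obtain ⟨s, w, hls, ho, -⟩ := id hl
  refine ⟨l, hls ▸ isLine_span_cubicVec ho, ?_⟩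
  ext m
  constructor
  · exact fun hm => exists_map_eq hε hl hm
  · rintro ⟨g, hg, rfl⟩
    exact map_mem_UnGClass hq hl hg

theorem UnGClass_ne : UnGClass F (-1) ≠ UnGClass F 1 := by
  intro h
  obtain ⟨l, hl⟩ := UnGClass_nonempty (F := F) (ε := 1) (Or.inl rfl)
  obtain ⟨s, w, rfl, ho, hh⟩ := id hl
  have h0 : hess w s ≠ 0 := ne_zero_of_quadraticChar (Or.inl rfl) hh
  rw [← h] at hl
  obtain ⟨t, heq, -, ht⟩ := mem_UnGClass_of_mem hl (mem_span_cubicVec_right s w) (by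
    rintro t c rfl
    have := hess_comb 0 c (cubicVec t) s
    rw [zero_smul, zero_add, hess_cubicVec, mul_zero] at this
    exact h0 this)
  obtain rfl := eq_of_cubicVec_mem_span h0 (heq ▸ cubicVec_mem_span t w)
  rw [hh] at ht
  norm_num at ht

end Group

/-! ### The planes with exactly two points of the cubic -/

section TwoPlanes

variable {F : Type*} [Field F]

theorem planeOf_eq_ker (c : Fin 4 → F) :
    planeOf c = LinearMap.ker (dotProductEquiv F (Fin 4) c) := by
  ext x
  rfl

theorem isPlane_planeOf {c : Fin 4 → F} (hc : c ≠ 0) : IsPlane (planeOf c) := by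
  have hf : dotProductEquiv F (Fin 4) c ≠ 0 := by simpa using hc
  have h := Module.Dual.finrank_ker_add_one_of_ne_zero hf
  rw [Module.finrank_fin_fun] at h
  rw [IsPlane, planeOf_eq_ker]
  omega

theorem exists_planeOf_of_isPlane {π : Submodule F (Fin 4 → F)} (hπ : IsPlane π) :
    ∃ c ≠ 0, π = planeOf c := by
  have hlt : π < ⊤ := by
    refine lt_top_iff_ne_top.2 fun h => ?_
    rw [IsPlane, h, finrank_top, Module.finrank_fin_fun] at hπ
    omega
  obtain ⟨f, hf, hle⟩ := Submodule.exists_le_ker_of_lt_top π hlt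
  obtain ⟨c, rfl⟩ := (dotProductEquiv F (Fin 4)).surjective f
  have hc : c ≠ 0 := by simpa using hf
  refine ⟨c, hc, Submodule.eq_of_le_of_finrank_eq (by rwa [planeOf_eq_ker]) ?_⟩
  rw [hπ, isPlane_planeOf hc]

theorem planeOf_smul {k : F} (hk : k ≠ 0) (c : Fin 4 → F) : planeOf (k • c) = planeOf c := by
  ext x
  change (k • c) ⬝ᵥ x = 0 ↔ c ⬝ᵥ x = 0
  simp [smul_dotProduct, hk]

theorem ncard_cubic_inter (π : Submodule F (Fin 4 → F)) :
    (cubic F ∩ pointsOn π).ncard = {s | cubicVec s ∈ π}.ncard := by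
  rw [← Set.ncard_image_of_injective _ cubicPoint_injective]
  congr 1
  ext p
  constructor
  · rintro ⟨⟨s, rfl⟩, h⟩
    exact ⟨s, (cubicPoint_mem_pointsOn _ _).1 h, rfl⟩
  · rintro ⟨s, h, rfl⟩
    exact ⟨⟨s, rfl⟩, (cubicPoint_mem_pointsOn _ _).2 h⟩

theorem smul_mem_pointsOn_map (g : (Fin 4 → F) ≃ₗ[F] (Fin 4 → F)) (p : ℙ F (Fin 4 → F))
    (π : Submodule F (Fin 4 → F)) :
    g • p ∈ pointsOn (Submodule.map (g : (Fin 4 → F) →ₗ[F] (Fin 4 → F)) π) ↔ p ∈ pointsOn π := by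
  induction p using Projectivization.ind with
  | h v hv =>
  rw [Projectivization.smul_mk, mk_mem_pointsOn, mk_mem_pointsOn, LinearEquiv.smul_def]
  constructor
  · rintro ⟨w, hw, h⟩
    rwa [← g.injective h]
  · exact fun h => ⟨v, h, rfl⟩

theorem map_mem_twoCPlanes {g : (Fin 4 → F) ≃ₗ[F] (Fin 4 → F)} (hg : g ∈ cubicGroup F)
    {π : Submodule F (Fin 4 → F)} (hπ : π ∈ twoCPlanes F) :
    Submodule.map (g : (Fin 4 → F) →ₗ[F] (Fin 4 → F)) π ∈ twoCPlanes F := by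
  obtain ⟨h1, h2⟩ := hπ
  refine ⟨(LinearEquiv.finrank_map_eq g π).trans h1, ?_⟩
  rw [← h2, ← Set.ncard_image_of_injective (cubic F ∩ pointsOn π) (MulAction.injective g)]
  congr 1
  have hg' : g • cubic F = cubic F := hg
  ext p
  constructor
  · rintro ⟨hp, hpπ⟩
    rw [← hg'] at hp
    obtain ⟨r, hr, rfl⟩ := hp
    exact ⟨r, ⟨hr, (smul_mem_pointsOn_map g r π).1 hpπ⟩, rfl⟩
  · rintro ⟨r, ⟨hr, hrπ⟩, rfl⟩
    refine ⟨?_, (smul_mem_pointsOn_map g r π).2 hrπ⟩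
    rw [← hg']
    exact Set.smul_mem_smul_set hr

theorem ncard_twoCPlanes_map {g : (Fin 4 → F) ≃ₗ[F] (Fin 4 → F)} (hg : g ∈ cubicGroup F)
    (l : Submodule F (Fin 4 → F)) :
    {π ∈ twoCPlanes F | Submodule.map (g : (Fin 4 → F) →ₗ[F] (Fin 4 → F)) l ≤ π}.ncard =
      {π ∈ twoCPlanes F | l ≤ π}.ncard := by
  have hinj : Function.Injective (Submodule.map (g : (Fin 4 → F) →ₗ[F] (Fin 4 → F))) :=
    Submodule.map_injective_of_injective g.injective
  rw [← Set.ncard_image_of_injective {π ∈ twoCPlanes F | l ≤ π} hinj]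
  congr 1
  ext π
  constructor
  · rintro ⟨h1, h2⟩
    have h := map_inv_map g⁻¹ π
    rw [inv_inv] at h
    refine ⟨_, ⟨map_mem_twoCPlanes (inv_mem hg) h1, ?_⟩, h⟩
    rw [← map_inv_map g l]
    exact Submodule.map_mono h2
  · rintro ⟨ρ, ⟨h1, h2⟩, rfl⟩
    exact ⟨map_mem_twoCPlanes hg h1, Submodule.map_mono h2⟩

theorem planeOf_linear_mem_twoCPlanes (b : F) : planeOf ![0, 0, 1, b] ∈ twoCPlanes F := by
  refine ⟨isPlane_planeOf fun h => by simpa using congrFun h 2, ?_⟩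
  rw [ncard_cubic_inter, Set.ncard_eq_two]
  refine ⟨none, some (-b), by simp, ?_⟩
  ext s
  cases s <;> simp [mem_planeOf, cubicVec_none, cubicVec_some, eq_neg_iff_add_eq_zero]

variable [Fintype F] [DecidableEq F]

/-- A plane through `P(∞)` given by a quadratic polynomial contains exactly one further point of the
cubic if and only if the polynomial has a double root. -/
theorem planeOf_quadratic_mem_twoCPlanes (hF : ringChar F ≠ 2) (m n : F) :
    planeOf ![0, 1, m, n] ∈ twoCPlanes F ↔ m ^ 2 = 4 * n := by
  have h2 : (2 : F) ≠ 0 := Ring.two_ne_zero hF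
  have h4 : (4 : F) ≠ 0 := by
    have := mul_ne_zero h2 h2
    norm_num at this
    exact this
  have hplane : IsPlane (planeOf ![0, 1, m, n]) :=
    isPlane_planeOf fun h => by simpa using congrFun h 1
  have hcount : ((cubic F ∩ pointsOn (planeOf ![0, 1, m, n])).ncard : ℤ) =
      quadraticChar F (m ^ 2 - 4 * n) + 2 := by
    classical
    have hroot : ∀ t, cubicVec (some t) ∈ planeOf ![0, 1, m, n] ↔
        (2 * t + m) ^ 2 = m ^ 2 - 4 * n := by
      intro t
      have : (2 * t + m) ^ 2 - (m ^ 2 - 4 * n) = 4 * (t ^ 2 + m * t + n) := by ring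
      rw [← sub_eq_zero (a := (2 * t + m) ^ 2), this, mul_eq_zero, or_iff_right h4]
      simp [mem_planeOf, cubicVec_some]
    have hnone : cubicVec none ∈ planeOf ![0, 1, m, n] := by simp [mem_planeOf, cubicVec_none]
    rw [ncard_cubic_inter, ncard_option, if_pos hnone]
    simp only [hroot]
    rw [ncard_preimage_of_bijective (affine_bijective m h2) (fun u => u ^ 2 = m ^ 2 - 4 * n),
      Nat.cast_add, ncard_sq_eq hF]
    push_cast
    ring
  constructor
  · rintro ⟨-, h⟩
    rw [h] at hcount
    have h0 : quadraticChar F (m ^ 2 - 4 * n) = 0 := by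
      push_cast at hcount
      linarith
    exact sub_eq_zero.1 (quadraticChar_eq_zero_iff.1 h0)
  · intro h
    refine ⟨hplane, ?_⟩
    rw [h, sub_self, quadraticChar_zero] at hcount
    exact_mod_cast hcount

theorem ncard_twoCPlanes_infty (hF : ringChar F ≠ 2) {w : Fin 4 → F} (hw : w 3 = 1) :
    ({π ∈ twoCPlanes F | Submodule.span F {cubicVec none, w} ≤ π}.ncard : ℤ) =
      2 + quadraticChar F (hess w none) := by
  have h2 : (2 : F) ≠ 0 := Ring.two_ne_zero hF
  have hle : ∀ c : Fin 4 → F, Submodule.span F {cubicVec none, w} ≤ planeOf c ↔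
      c 0 = 0 ∧ c 1 * w 1 + c 2 * w 2 + c 3 = 0 := by
    intro c
    rw [Submodule.span_le, Set.insert_subset_iff, Set.singleton_subset_iff, SetLike.mem_coe,
      SetLike.mem_coe, mem_planeOf, mem_planeOf]
    simp only [cubicVec_none, hw]
    simp
    intro h0
    simp [h0]
  have hquad : ∀ m, m ^ 2 = 4 * (-(w 1) - m * w 2) ↔ (m + 2 * w 2) ^ 2 = 2 ^ 2 * hess w none := by
    intro m
    rw [hess_none, hw]
    constructor <;> intro h <;> linear_combination h
  have hset : {π ∈ twoCPlanes F | Submodule.span F {cubicVec none, w} ≤ π} =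
      insert (planeOf ![0, 0, 1, -w 2]) ((fun m => planeOf ![0, 1, m, -(w 1) - m * w 2]) ''
        {m | (m + 2 * w 2) ^ 2 = 2 ^ 2 * hess w none}) := by
    ext π
    constructor
    · rintro ⟨hπ, hl⟩
      obtain ⟨c, hc, rfl⟩ := exists_planeOf_of_isPlane hπ.1
      obtain ⟨h0, h1⟩ := (hle c).1 hl
      by_cases hc1 : c 1 = 0
      · left
        rw [hc1] at h1
        have hc2 : c 2 ≠ 0 := by
          intro hc2
          rw [hc2] at h1
          refine hc (funext fun i => ?_)
          fin_cases i
          · exact h0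
          · exact hc1
          · exact hc2
          · simpa using h1
        change planeOf c = _
        rw [← planeOf_smul hc2 ![0, 0, 1, -w 2]]
        congr 1
        ext i
        fin_cases i <;> simp [h0, hc1]
        linear_combination h1
      · right
        have heq : planeOf c = planeOf ![0, 1, c 2 / c 1, -(w 1) - c 2 / c 1 * w 2] := by
          rw [← planeOf_smul hc1 ![0, 1, c 2 / c 1, -(w 1) - c 2 / c 1 * w 2]]
          congr 1
          ext i
          fin_cases i <;> simp [h0]
          · field_simp
          · field_simp
            linear_combination h1
        refine ⟨c 2 / c 1, ?_, heq.symm⟩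
        rw [heq, planeOf_quadratic_mem_twoCPlanes hF] at hπ
        exact (hquad _).1 hπ
    · rintro (rfl | ⟨m, hm, rfl⟩)
      · refine ⟨planeOf_linear_mem_twoCPlanes _, (hle _).2 ?_⟩
        simp
      · refine ⟨(planeOf_quadratic_mem_twoCPlanes hF _ _).2 ((hquad m).2 hm), (hle _).2 ?_⟩
        simp
  have hinj : Function.Injective fun m => planeOf ![0, 1, m, -(w 1) - m * w 2] := by
    intro m m' h
    simp only at h
    have hmem : ![0, -m, 1, 0] ∈ planeOf ![0, 1, m, -(w 1) - m * w 2] := by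
      rw [mem_planeOf]
      simp
    rw [h, mem_planeOf] at hmem
    simp at hmem
    linear_combination -hmem
  have hnot : planeOf ![0, 0, 1, -w 2] ∉ (fun m => planeOf ![0, 1, m, -(w 1) - m * w 2]) ''
      {m | (m + 2 * w 2) ^ 2 = 2 ^ 2 * hess w none} := by
    rintro ⟨m, -, h⟩
    simp only at h
    have hmem : ![0, 1, 0, 0] ∈ planeOf ![0, 0, 1, -w 2] := by
      rw [mem_planeOf]
      simp
    rw [← h, mem_planeOf] at hmem
    simp at hmem
  have hshift : Function.Bijective fun m : F => m + 2 * w 2 := (Equiv.addRight _).bijective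
  rw [hset, Set.ncard_insert_of_notMem hnot, Set.ncard_image_of_injective _ hinj,
    ncard_preimage_of_bijective hshift
      (fun u => u ^ 2 = 2 ^ 2 * hess w none), Nat.cast_add, ncard_sq_eq hF, map_mul,
    quadraticChar_sq_one' h2]
  push_cast
  ring

theorem ncard_twoCPlanes_UnGClass [CharP F 3] {ε : ℤ}
    {l : Submodule F (Fin 4 → F)} (hl : l ∈ UnGClass F ε) :
    ({π ∈ twoCPlanes F | l ≤ π}.ncard : ℤ) = 2 + ε := by
  obtain ⟨s, w, rfl, ho, hh⟩ := exists_normalized hl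
  rw [← ncard_twoCPlanes_map (toInfty_mem s), map_toInfty,
    ncard_twoCPlanes_infty ringChar_ne_two, hess_toInfty, hh]
  rw [← osc_none (toInfty s w), osc_toInfty, ho]

end TwoPlanes

theorem charP_three_of_card {F : Type*} [Field F] [Fintype F] (h : 3 ∣ Fintype.card F) :
    CharP F 3 := by
  obtain ⟨p, hp⟩ := CharP.exists F
  obtain ⟨n, hpp, hn⟩ := FiniteField.card F p
  rw [hn] at h
  have h3 := (Nat.prime_dvd_prime_iff_eq Nat.prime_three hpp).1 (Nat.prime_three.dvd_of_dvd_pow h)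
  rwa [h3]

end TwistedCubic

theorem mainTheorem6 {F : Type*} [Field F] [Finite F] (q : ℕ) (hcard : Nat.card F = q)
    (hq3 : q ≡ 0 [MOD 3]) (hq5 : 5 ≤ q) :
    ∃ O₁ O₂ : Set (Submodule F (Fin 4 → F)),
      TwistedCubic.AreUnGOrbits O₁ O₂ ∧
      -- numbers of points on a line
      (∀ l ∈ O₁,
        TwistedCubic.numPointsOn (TwistedCubic.TOPoints F) l = 0 ∧
        (TwistedCubic.numPointsOn (TwistedCubic.ICPoints F) l : ℚ) = ((q : ℚ) + 1) / 2 ∧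
        (TwistedCubic.numPointsOn (TwistedCubic.RCPoints F) l : ℚ) = ((q : ℚ) - 1) / 2) ∧
      (∀ l ∈ O₂,
        TwistedCubic.numPointsOn (TwistedCubic.TOPoints F) l = 2 ∧
        (TwistedCubic.numPointsOn (TwistedCubic.ICPoints F) l : ℚ) = ((q : ℚ) - 1) / 2 ∧
        (TwistedCubic.numPointsOn (TwistedCubic.RCPoints F) l : ℚ) = ((q : ℚ) - 3) / 2) ∧
      -- numbers of lines through a point
      (∀ p ∈ TwistedCubic.TOPoints F,
        TwistedCubic.numLinesThrough O₁ p = 0 ∧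
        TwistedCubic.numLinesThrough O₂ p = q) ∧
      (∀ p ∈ TwistedCubic.ICPoints F,
        (TwistedCubic.numLinesThrough O₁ p : ℚ) = ((q : ℚ) + 1) / 2 ∧
        (TwistedCubic.numLinesThrough O₂ p : ℚ) = ((q : ℚ) - 1) / 2) ∧
      (∀ p ∈ TwistedCubic.RCPoints F,
        (TwistedCubic.numLinesThrough O₁ p : ℚ) = ((q : ℚ) - 1) / 2 ∧
        (TwistedCubic.numLinesThrough O₂ p : ℚ) = ((q : ℚ) - 3) / 2) := by
  classical
  have := Fintype.ofFinite F
  rw [Nat.card_eq_fintype_card] at hcard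
  subst hcard
  have : CharP F 3 := TwistedCubic.charP_three_of_card (Nat.modEq_zero_iff_dvd.1 hq3)
  have hrat : ∀ {n : ℕ} {z : ℤ}, 2 * (n : ℤ) = z → (n : ℚ) = (z : ℚ) / 2 := by
    intro n z h
    have : 2 * (n : ℚ) = z := by exact_mod_cast h
    linarith
  refine ⟨TwistedCubic.UnGClass F (-1), TwistedCubic.UnGClass F 1,
    ⟨TwistedCubic.isLineOrbit_UnGClass hq5 (by simp), TwistedCubic.isLineOrbit_UnGClass hq5 (by simp),
      TwistedCubic.UnGClass_ne, TwistedCubic.UnGClass_union, fun l hl => ?_, fun l hl => ?_⟩,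
    fun l hl => ?_, fun l hl => ?_,
    fun p hp => TwistedCubic.numLinesThrough_of_mem_TOPoints hp, fun p hp => ?_, fun p hp => ?_⟩
  · have h := TwistedCubic.ncard_twoCPlanes_UnGClass hl
    omega
  · have h := TwistedCubic.ncard_twoCPlanes_UnGClass hl
    omega
  · obtain ⟨h1, h2, h3⟩ := TwistedCubic.numPointsOn_UnGClass (by simp) hl
    refine ⟨by omega, ?_, ?_⟩
    · rw [hrat h2]
      push_cast
      ring
    · rw [hrat h3]
      push_cast
      ring
  · obtain ⟨h1, h2, h3⟩ := TwistedCubic.numPointsOn_UnGClass (by simp) hl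
    refine ⟨by omega, ?_, ?_⟩
    · rw [hrat h2]
      push_cast
      ring
    · rw [hrat h3]
      push_cast
      ring
  · induction p using Projectivization.ind with
    | h v hv =>
    have hχ := (TwistedCubic.mk_mem_ICPoints TwistedCubic.ringChar_ne_two hv).1 hp
    obtain ⟨h1, h2⟩ := TwistedCubic.two_mul_numLinesThrough hv
      (TwistedCubic.ne_zero_of_quadraticChar (Or.inr rfl) hχ)
    rw [hrat h1, hrat h2, hχ]
    push_cast
    constructor <;> ring
  · induction p using Projectivization.ind with
    | h v hv =>
    have hχ := (TwistedCubic.mk_mem_RCPoints TwistedCubic.two_ne_zero_of_charP_three hv).1 hp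
    obtain ⟨h1, h2⟩ := TwistedCubic.two_mul_numLinesThrough hv
      (TwistedCubic.ne_zero_of_quadraticChar (Or.inl rfl) hχ)
    rw [hrat h1, hrat h2, hχ]
    push_cast
    constructor <;> ring
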